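/- **Setting.** Let $T\ge 0$, let $\mathbb{T}^d=\mathbb{R}^d/\mathbb{Z}^d$ with the metric $\|x-y\|=\min\{\|x'-y'\|:x'\in x,\,y'\in y\}$ induced by the Euclidean norm, let $\mathcal{P}^2(\mathbb{T}^d)$ be the set of Borel probabilities on $\mathbb{T}^d$ (with finite second moment) with the 2-Wasserstein metric $W_2$, and let $U,V$ be nonempty compact metric spaces. Let $f:[0,T]\times\mathbb{T}^d\times\mathcal{P}^2(\mathbb{T}^d)\times U\times V\to\mathbb{R}^d$ and $g:\mathcal{P}^2(\mathbb{T}^d)\to\mathbb{R}$ be continuous, let $f$ be Lipschitz in $(x,m)$ uniformly in $(t,u,v)$, and assume the Isaacs condition: for all $t$, $x$, $m$ and all $w\in\mathbb{R}^d$, $$\min_{u\in U}\max_{v\in V}\langle w,f(t,x,m,u,v)\rangle=\max_{v\in V}\min_{u\in U}\langle w,f(t,x,m,u,v)\rangle .$$ **Controls.** For separable metric spaces $X,Y$ let $\mathrm{WM}(X,Y)$ be the set of (weakly) measurable maps from $X$ to the Borel probabilities on $Y$. For $m$ a finite measure on $X$ and $b\in\mathrm{WM}(X,Y)$, $m\star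 b$ denotes the measure $b(x,dy)\,m(dx)$ on $X\times Y$. For a compact metric space $Y$ the relaxed controls $\Lambda(Y)$ are the elements of $\mathrm{WM}([0,T],Y)$ modulo equality Lebesgue-almost everywhere, with the topology of narrow convergence of $\lambda\star\eta$, where $\lambda$ is the Lebesgue measure on $[0,T]$. Put $\mathcal{U}=\Lambda(U)$, $\mathcal{V}=\Lambda(V)$, $\mathcal{W}=\Lambda(U\times V)$. Let $\mathcal{U}^0\subset\mathcal{U}$, $\mathcal{V}^0\subset\mathcal{V}$ be the usual controls $t\mapsto\delta_{h(t)}$ with $h$ measurable, regard elements of $U$, $V$ as constant controls, and regard $(\xi,\zeta)\in\mathcal{U}\times\mathcal{V}$ as the element $t\mapsto\xi(t)\otimes\zeta(t)$ of $\mathcal{W}$. Put $\mathcal{A}^c=\mathrm{WM}(\mathbb{T}^d,U)$ and $\mathcal{B}^c=\mathrm{WM}(\mathbb{T}^d,V)$. For $\alpha\in\mathcal{A}^c$ let $\mathcal{D}_1[\alpha]$ be the set of $\varkappa\in\mathrm{WM}(\mathbb{T}^d,\mathcal{U}\times\mathcal{V})$ such that for each $x$ the marginal of $\varkappa(x)$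 on $\mathcal{U}$ is $\alpha(x)$, and let $\mathcal{D}_1^0[\alpha]$ be the set of those $\varkappa\in\mathcal{D}_1[\alpha]$ for which every $\varkappa(x)$ is concentrated on $\mathcal{U}\times\mathcal{V}^0$. For $\beta\in\mathcal{B}^c$ define $\mathcal{D}_2[\beta]$ by the condition that the marginal of $\varkappa(x)$ on $\mathcal{V}$ is $\beta(x)$, and $\mathcal{D}_2^0[\beta]$ by requiring in addition that every $\varkappa(x)$ is concentrated on $\mathcal{U}^0\times\mathcal{V}$. **Flows.** For $s\in[0,T]$, a continuous $m:[0,T]\to\mathcal{P}^2(\mathbb{T}^d)$, $y\in\mathbb{T}^d$ and $\eta\in\mathcal{W}$ let $\mathrm{traj}^s_{m}(y,\eta)\in C([0,T],\mathbb{T}^d)$ be the solution of $\dot x(t)=\int f(t,x(t),m(t),u,v)\,\eta(t,d(u,v))$, $x(s)=y$. For $m_*\in\mathcal{P}^2(\mathbb{T}^d)$ and $\varkappa\in\mathrm{WM}(\mathbb{T}^d,\mathcal{U}\times\mathcal{V})$, $m(\cdot)=m(\cdot,s,m_*,\varkappa)$ denotes the continuous flow of probabilities for which there is a probability $\gamma$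 on $C([0,T],\mathbb{T}^d)$ such that $m(t)$ is the image of $\gamma$ under $x(\cdot)\mapsto x(t)$ for all $t$, $m(s)=m_*$, and $\gamma$ is the image of $m_*\star\varkappa$ under $\mathrm{traj}^s_{m}$. **Values.** A strategy of the first player is any map $\mathfrak{u}:[0,T]\times\mathcal{P}^2(\mathbb{T}^d)\to\mathcal{A}^c$. For a partition $\Delta=\{t_0<\dots<t_N=T\}$ of $[t_0,T]$ let $\mathcal{X}_1(t_0,m_0,\mathfrak{u},\Delta)$ be the set of flows $m(\cdot)$ on $[t_0,T]$ with $m(t_0)=m_0$ such that for each $i<N$ there is $\varkappa_i\in\mathcal{D}_1^0[\mathfrak{u}[t_i,m(t_i)]]$ with $m(t)=m(t,t_i,m(t_i),\varkappa_i)$ for $t\in[t_i,t_{i+1}]$. The upper value is $$\Gamma_1(t_0,m_0)=\inf_{\mathfrak{u},\Delta}\ \sup\{g(m(T)):m(\cdot)\in\mathcal{X}_1(t_0,m_0,\mathfrak{u},\Delta)\}.$$ Symmetrically, with strategies $\mathfrak{v}:[0,T]\times\mathcal{P}^2(\mathbb{T}^d)\to\mathcal{B}^c$ of the second player and $\mathcal{D}_2^0[\mathfrak{v}[t_i,m(t_i)]]$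 in place of $\mathcal{D}_1^0[\mathfrak{u}[t_i,m(t_i)]]$, one defines $\mathcal{X}_2$ and the lower value $\Gamma_2(t_0,m_0)=\sup_{\mathfrak{v},\Delta}\inf\{g(m(T)):m(\cdot)\in\mathcal{X}_2(t_0,m_0,\mathfrak{v},\Delta)\}$. **Stability.** A lower semicontinuous $\psi_1:[0,T]\times\mathcal{P}^2(\mathbb{T}^d)\to\mathbb{R}$ is $u$-stable if $g(m)\le\psi_1(T,m)$ for all $m$ and, for all $s<r$ in $[0,T]$, all $m_*$ and all $\beta\in\mathcal{B}^c$, there is $\varkappa\in\mathcal{D}_2[\beta]$ with $\psi_1(s,m_*)\ge\psi_1(r,m(r,s,m_*,\varkappa))$. An upper semicontinuous $\psi_2:[0,T]\times\mathcal{P}^2(\mathbb{T}^d)\to\mathbb{R}$ is $v$-stable if $g(m)\ge\psi_2(T,m)$ for all $m$ and, for all $s<r$ in $[0,T]$, all $m_*$ and all $\alpha\in\mathcal{A}^c$, there is $\varkappa\in\mathcal{D}_1[\alpha]$ with $\psi_2(s,m_*)\le\psi_2(r,m(r,s,m_*,\varkappa))$. **Theorem.** If $\psi_1$ is $u$-stable,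 then $\Gamma_1(t_0,m_0)\le\psi_1(t_0,m_0)$ for all $(t_0,m_0)\in[0,T]\times\mathcal{P}^2(\mathbb{T}^d)$. If $\psi_2$ is $v$-stable, then $\Gamma_2(t_0,m_0)\ge\psi_2(t_0,m_0)$ for all $(t_0,m_0)\in[0,T]\times\mathcal{P}^2(\mathbb{T}^d)$. -/

import Mathlib

open MeasureTheory ProbabilityTheory Filter Topology
open scoped NNReal ENNReal BoundedContinuousFunction

namespace MeanFieldGame

noncomputable section

/-! ### Square-integrable probabilities and the Wasserstein distance -/

section Wasserstein

variable (X : Type*) [PseudoMetricSpace X] [MeasurableSpace X]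

/-- Probabilities on `X` with finite second moment. -/
def P2 : Type _ :=
  {m : Measure X // IsProbabilityMeasure m ∧ ∃ a : X, ∫⁻ x, edist x a ^ 2 ∂m < ∞}

variable {X}

/-- The underlying measure. -/
def P2.meas (m : P2 X) : Measure X := m.1

instance (m : P2 X) : IsProbabilityMeasure m.meas := m.2.1

/-- Plans between two measures: measures on the product with the prescribed marginals. -/
def plans (m₁ m₂ : Measure X) : Set (Measure (X × X)) :=
  {π | π.map Prod.fst = m₁ ∧ π.map Prod.snd = m₂}

/-- The 2-Wasserstein distance (the infimum is finite on `P2 X`). -/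
def W2 (m₁ m₂ : P2 X) : ℝ :=
  √(⨅ π ∈ plans m₁.meas m₂.meas, ∫⁻ p, edist p.1 p.2 ^ 2 ∂π).toReal

/-- The metric topology of the 2-Wasserstein distance: a set is open iff together with each of its
points it contains a `W2`-ball around the point. -/
instance : TopologicalSpace (P2 X) where
  IsOpen S := ∀ m ∈ S, ∃ ε : ℝ, 0 < ε ∧ ∀ m' : P2 X, W2 m m' < ε → m' ∈ S
  isOpen_univ := fun _ _ => ⟨1, one_pos, fun _ _ => Set.mem_univ _⟩
  isOpen_inter := fun S S' hS hS' m hm => by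
    obtain ⟨ε, hε, h⟩ := hS m hm.1
    obtain ⟨ε', hε', h'⟩ := hS' m hm.2
    exact ⟨min ε ε', lt_min hε hε', fun m' hm' =>
      ⟨h m' (hm'.trans_le (min_le_left _ _)), h' m' (hm'.trans_le (min_le_right _ _))⟩⟩
  isOpen_sUnion := fun 𝒮 h𝒮 m hm => by
    obtain ⟨S, hS, hmS⟩ := hm
    obtain ⟨ε, hε, h⟩ := h𝒮 S hS m hmS
    exact ⟨ε, hε, fun m' hm' => ⟨S, hS, h m' hm'⟩⟩

end Wasserstein

/-! ### Measurable families of probabilities and relaxed controls -/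

/-- Weakly measurable functions from `X` to the probabilities on `Y`, i.e. Markov kernels. -/
def WM (X Y : Type*) [MeasurableSpace X] [MeasurableSpace Y] : Type _ :=
  {κ : Kernel X Y // IsMarkovKernel κ}

/-- The underlying kernel. -/
def WM.ker {X Y : Type*} [MeasurableSpace X] [MeasurableSpace Y] (b : WM X Y) : Kernel X Y := b.1

instance {X Y : Type*} [MeasurableSpace X] [MeasurableSpace Y] (b : WM X Y) :
    IsMarkovKernel b.ker := b.2

/-- The time interval `[0, T]`; it carries the Lebesgue measure `volume`. -/
abbrev Time (T : ℝ≥0) : Type := Set.Icc (0 : ℝ) T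

/-- The terminal time `T`. -/
def endTime (T : ℝ≥0) : Time T := ⟨T, T.2, le_rfl⟩

instance (T : ℝ≥0) : MeasureSpace (Time T) := Measure.Subtype.measureSpace

instance (T : ℝ≥0) : IsFiniteMeasure (volume : Measure (Time T)) := by
  refine ⟨?_⟩
  rw [Measure.Subtype.volume_univ measurableSet_Icc.nullMeasurableSet]
  exact measure_Icc_lt_top

section Relaxed

variable (T : ℝ≥0) (Y : Type*) [MeasurableSpace Y]

/-- Coincidence almost everywhere with respect to the Lebesgue measure on `[0, T]`. -/
def relaxedSetoid : Setoid (WM (Time T) Y) where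
  r b c := ∀ᵐ t : Time T, b.ker t = c.ker t
  iseqv := ⟨fun _ => ae_of_all _ fun _ => rfl, fun h => h.mono fun _ ht => ht.symm,
    fun h h' => by filter_upwards [h, h'] with t ht ht' using ht.trans ht'⟩

/-- Relaxed controls on `[0, T]` with values in `Y`. -/
def Relaxed : Type _ := Quotient (relaxedSetoid T Y)

variable {T Y}

/-- The relaxed control defined by a measurable family of probabilities. -/
def Relaxed.mk (b : WM (Time T) Y) : Relaxed T Y := Quotient.mk (relaxedSetoid T Y) b

/-- A representative of a relaxed control (unique up to a null set of times). -/
def Relaxed.rep (η : Relaxed T Y) : WM (Time T) Y := Quotient.out η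

/-- The measure `λ ⋆ η` on `[0, T] × Y`, where `λ` is the Lebesgue measure. -/
def Relaxed.toMeasure (η : Relaxed T Y) : FiniteMeasure (Time T × Y) :=
  Quotient.lift (s := relaxedSetoid T Y)
    (fun b => (⟨(volume : Measure (Time T)) ⊗ₘ b.ker, inferInstance⟩ : FiniteMeasure (Time T × Y)))
    (fun b c (h : ∀ᵐ t : Time T, b.ker t = c.ker t) =>
      Subtype.ext (Measure.compProd_congr h)) η

/-- The usual control `h`, regarded as the relaxed control `t ↦ δ_{h(t)}`. -/
def Relaxed.ofFun (h : Time T → Y) (hh : Measurable h) : Relaxed T Y :=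
  Relaxed.mk ⟨Kernel.deterministic h hh, inferInstance⟩

/-- The constant control `u`, regarded as a relaxed control. -/
def Relaxed.const (u : Y) : Relaxed T Y := Relaxed.ofFun (fun _ => u) measurable_const

variable (T Y) in
/-- The usual (measurable) controls inside the set of relaxed controls. -/
def usualControls : Set (Relaxed T Y) :=
  {η | ∃ (h : Time T → Y) (hh : Measurable h), η = Relaxed.ofFun h hh}

/-- The joint relaxed control `ξ ζ`, given by `(ξ ζ)(t) = ξ(t) ⊗ ζ(t)`. -/
def Relaxed.prod {Z : Type*} [MeasurableSpace Z] (ξ : Relaxed T Y) (ζ : Relaxed T Z) :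
    Relaxed T (Y × Z) :=
  Quotient.map₂ (sa := relaxedSetoid T Y) (sb := relaxedSetoid T Z) (sc := relaxedSetoid T (Y × Z))
    (fun b c => ⟨b.ker ×ₖ c.ker, inferInstance⟩)
    (fun b b' (hb : ∀ᵐ t : Time T, b.ker t = b'.ker t) c c'
        (hc : ∀ᵐ t : Time T, c.ker t = c'.ker t) => by
      change ∀ᵐ t : Time T, (b.ker ×ₖ c.ker) t = (b'.ker ×ₖ c'.ker) t
      filter_upwards [hb, hc] with t ht ht'
      rw [Kernel.prod_apply, Kernel.prod_apply, ht, ht']) ξ ζ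

variable [TopologicalSpace Y] [OpensMeasurableSpace Y]

/-- The topology of narrow convergence of the measures `λ ⋆ η`. -/
instance : TopologicalSpace (Relaxed T Y) := TopologicalSpace.induced Relaxed.toMeasure inferInstance

instance : MeasurableSpace (Relaxed T Y) := borel _

instance : BorelSpace (Relaxed T Y) := ⟨rfl⟩

lemma Relaxed.lintegral_const_control (u : Y) (φ : (Time T × Y) →ᵇ ℝ≥0) :
    (∫⁻ z, φ z ∂((Relaxed.const u : Relaxed T Y).toMeasure : Measure (Time T × Y)))
      = ∫⁻ t : Time T, φ (t, u) := by
  change (∫⁻ z, φ z ∂((volume : Measure (Time T)) ⊗ₘ Kernel.deterministic (fun _ => u) measurable_const)) = _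
  have hφ : Measurable fun z => (φ z : ℝ≥0∞) := φ.continuous.measurable.coe_nnreal_ennreal
  rw [Measure.lintegral_compProd hφ]
  refine lintegral_congr fun t => ?_
  rw [Kernel.deterministic_apply,
    lintegral_dirac' (f := fun y => (φ (t, y) : ℝ≥0∞)) u (hφ.comp measurable_prodMk_left)]

lemma Relaxed.measurable_const_control [BorelSpace Y] [FirstCountableTopology Y] :
    Measurable (Relaxed.const : Y → Relaxed T Y) := by
  refine Continuous.measurable ?_
  rw [continuous_induced_rng, continuous_iff_continuousAt]
  intro u
  rw [ContinuousAt, FiniteMeasure.tendsto_iff_forall_lintegral_tendsto]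
  intro φ
  simp only [Function.comp_apply, Relaxed.lintegral_const_control]
  refine tendsto_lintegral_filter_of_dominated_convergence (fun _ => (nndist φ 0 : ℝ≥0∞)) ?_ ?_ ?_ ?_
  · exact Eventually.of_forall fun v =>
      (φ.continuous.measurable.comp measurable_prodMk_right).coe_nnreal_ennreal
  · refine Eventually.of_forall fun v => ae_of_all _ fun t => ?_
    exact_mod_cast BoundedContinuousFunction.NNReal.upper_bound φ (t, v)
  · rw [lintegral_const]
    exact ENNReal.mul_ne_top ENNReal.coe_ne_top (measure_ne_top _ _)
  · refine ae_of_all _ fun t => ENNReal.tendsto_coe.2 ?_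
    exact (φ.continuous.comp (by fun_prop : Continuous fun v : Y => (t, v))).tendsto u

end Relaxed

/-! ### The flat torus -/

/-- The lattice `ℤ^d` in `ℝ^d`. -/
def intLattice (d : ℕ) : AddSubgroup (EuclideanSpace ℝ (Fin d)) where
  carrier := {x | ∀ i, ∃ k : ℤ, (k : ℝ) = x i}
  zero_mem' := fun _ => ⟨0, by simp⟩
  add_mem' := fun {x y} hx hy i => by
    obtain ⟨k, hk⟩ := hx i
    obtain ⟨l, hl⟩ := hy i
    exact ⟨k + l, by simp [hk, hl]⟩
  neg_mem' := fun {x} hx i => by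
    obtain ⟨k, hk⟩ := hx i
    exact ⟨-k, by simp [hk]⟩

instance (d : ℕ) : IsClosed (intLattice d : Set (EuclideanSpace ℝ (Fin d))) := by
  have h : (intLattice d : Set (EuclideanSpace ℝ (Fin d)))
      = ⋂ i, (fun x : EuclideanSpace ℝ (Fin d) => x i) ⁻¹' Set.range (fun k : ℤ => (k : ℝ)) := by
    ext x
    simp [intLattice]
  rw [h]
  exact isClosed_iInter fun i =>
    Int.isClosedEmbedding_coe_real.isClosed_range.preimage (by fun_prop)

/-- The torus `ℝ^d / ℤ^d`, with the quotient of the Euclidean metric. -/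
abbrev Torus (d : ℕ) : Type := EuclideanSpace ℝ (Fin d) ⧸ intLattice d

/-- The Borel sigma-algebra on the space of continuous curves with the uniform metric. -/
instance (T : ℝ≥0) (d : ℕ) : MeasurableSpace C(Time T, Torus d) := borel _

instance (T : ℝ≥0) (d : ℕ) : BorelSpace C(Time T, Torus d) := ⟨rfl⟩

/-! ### Dynamics -/

section Dynamics

variable {T : ℝ≥0} {d : ℕ} {U V : Type*}
  [MetricSpace U] [CompactSpace U] [MeasurableSpace U] [BorelSpace U]
  [MetricSpace V] [CompactSpace V] [MeasurableSpace V] [BorelSpace V]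

/-- The vector field averaged over the joint relaxed control `η` at time `τ`. -/
def velocity (f : Time T → Torus d → P2 (Torus d) → U → V → EuclideanSpace ℝ (Fin d))
    (m : C(Time T, P2 (Torus d))) (η : Relaxed T (U × V)) (x : C(Time T, Torus d)) (τ : Time T) :
    EuclideanSpace ℝ (Fin d) :=
  ∫ w : U × V, f τ (x τ) (m τ) w.1 w.2 ∂(η.rep.ker τ)

/-- `x` solves `x'(t) = ∫ f(t, x(t), m(t), u, v) η(t, d(u, v))`, `x(s) = y`, on `[0, T]`, in the
integral form: `x(t) = y + [∫_s^t velocity]` for all `t`, where the integral is oriented, so that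
the equation is solved on both sides of `s`. -/
def IsMotion (f : Time T → Torus d → P2 (Torus d) → U → V → EuclideanSpace ℝ (Fin d))
    (s : Time T) (y : Torus d) (m : C(Time T, P2 (Torus d))) (η : Relaxed T (U × V))
    (x : C(Time T, Torus d)) : Prop :=
  ∀ t : Time T, x t = y + QuotientAddGroup.mk
    ((∫ τ in Set.Ioc s t, velocity f m η x τ) - ∫ τ in Set.Ioc t s, velocity f m η x τ)

/-- The operator that assigns to `(y, η)` the solution of the initial value problem. -/
def traj (f : Time T → Torus d → P2 (Torus d) → U → V → EuclideanSpace ℝ (Fin d))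
    (s : Time T) (m : C(Time T, P2 (Torus d))) (y : Torus d) (η : Relaxed T (U × V)) :
    C(Time T, Torus d) :=
  Classical.epsilon (IsMotion f s y m η)

/-- Distributions of pairs of relaxed controls of the two players. -/
abbrev PairDistr (T : ℝ≥0) (d : ℕ) (U V : Type*)
    [MetricSpace U] [MeasurableSpace U] [BorelSpace U]
    [MetricSpace V] [MeasurableSpace V] [BorelSpace V] : Type _ :=
  WM (Torus d) (Relaxed T U × Relaxed T V)

/-- `m` is a flow of probabilities generated by the distribution of controls `κ` and the
initial position `(s, mStar)`: there is a probability `γ` on the space of curves whose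
time marginals are `m`, with `m(s) = mStar` and `γ = traj # (mStar ⋆ κ)`.
A pair `(ξ, ζ)` of controls acts as the joint relaxed control `ξ ζ`. -/
def IsFlow (f : Time T → Torus d → P2 (Torus d) → U → V → EuclideanSpace ℝ (Fin d))
    (s : Time T) (mStar : P2 (Torus d)) (κ : PairDistr T d U V)
    (m : C(Time T, P2 (Torus d))) : Prop :=
  ∃ γ : P2 C(Time T, Torus d),
    (∀ t, (m t).meas = γ.meas.map fun x => x t) ∧
    m s = mStar ∧
    γ.meas = (mStar.meas ⊗ₘ κ.ker).map fun p => traj f s m p.1 (p.2.1.prod p.2.2)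

/-! ### Distributions of controls consistent with the choice of one player -/

/-- A distribution of constant controls as a distribution of relaxed controls. -/
def constToRelaxed {Y : Type*} [MetricSpace Y] [MeasurableSpace Y] [BorelSpace Y]
    (α : WM (Torus d) Y) : WM (Torus d) (Relaxed T Y) :=
  ⟨α.ker.map Relaxed.const, Kernel.IsMarkovKernel.map _ Relaxed.measurable_const_control⟩

/-- Distributions of controls of both players consistent with the distribution `α` of
the controls of the first player. -/
def D1 (α : WM (Torus d) (Relaxed T U)) : Set (PairDistr T d U V) :=
  {κ | ∀ x, (κ.ker x).map Prod.fst = α.ker x}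

/-- The elements of `D1 α` for which the second player uses only usual controls. -/
def D1usual (α : WM (Torus d) (Relaxed T U)) : Set (PairDistr T d U V) :=
  {κ | κ ∈ D1 α ∧ ∀ x, ∀ᵐ p ∂(κ.ker x), p.2 ∈ usualControls T V}

/-- Distributions of controls of both players consistent with the distribution `β` of
the controls of the second player. -/
def D2 (β : WM (Torus d) (Relaxed T V)) : Set (PairDistr T d U V) :=
  {κ | ∀ x, (κ.ker x).map Prod.snd = β.ker x}

/-- The elements of `D2 β` for which the first player uses only usual controls. -/
def D2usual (β : WM (Torus d) (Relaxed T V)) : Set (PairDistr T d U V) :=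
  {κ | κ ∈ D2 β ∧ ∀ x, ∀ᵐ p ∂(κ.ker x), p.1 ∈ usualControls T U}

/-! ### Feedback strategies, outcomes and values -/

/-- Feedback strategies of a player with control space `Y`: to each position they assign a
distribution of constant controls. -/
abbrev Strategy (T : ℝ≥0) (d : ℕ) (Y : Type*) [MeasurableSpace Y] : Type _ :=
  Time T → P2 (Torus d) → WM (Torus d) Y

/-- Partitions `t₀ = pts 0 < pts 1 < ... < pts N = T` of `[t₀, T]`. -/
structure Partition {T : ℝ≥0} (t₀ : Time T) where
  N : ℕ
  pts : Fin (N + 1) → Time T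
  strictMono : StrictMono pts
  first : pts 0 = t₀
  last : pts (Fin.last N) = endTime T

/-- Flows of probabilities generated by `t₀`, `m₀`, the strategy `𝔲` of the first player and the
partition `Δ`. Only the values on `[t₀, T]` are constrained and used. -/
def X1 (f : Time T → Torus d → P2 (Torus d) → U → V → EuclideanSpace ℝ (Fin d))
    (t₀ : Time T) (m₀ : P2 (Torus d)) (𝔲 : Strategy T d U) (Δ : Partition t₀) :
    Set (Time T → P2 (Torus d)) :=
  {m | m t₀ = m₀ ∧ ∀ i : Fin Δ.N,
    ∃ κ ∈ D1usual (V := V) (constToRelaxed (𝔲 (Δ.pts i.castSucc) (m (Δ.pts i.castSucc)))),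
      ∃ μ : C(Time T, P2 (Torus d)), IsFlow f (Δ.pts i.castSucc) (m (Δ.pts i.castSucc)) κ μ ∧
        ∀ t, Δ.pts i.castSucc ≤ t → t ≤ Δ.pts i.succ → m t = μ t}

/-- Flows of probabilities generated by `t₀`, `m₀`, the strategy `𝔳` of the second player and the
partition `Δ`. -/
def X2 (f : Time T → Torus d → P2 (Torus d) → U → V → EuclideanSpace ℝ (Fin d))
    (t₀ : Time T) (m₀ : P2 (Torus d)) (𝔳 : Strategy T d V) (Δ : Partition t₀) :
    Set (Time T → P2 (Torus d)) :=
  {m | m t₀ = m₀ ∧ ∀ i : Fin Δ.N,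
    ∃ κ ∈ D2usual (U := U) (constToRelaxed (𝔳 (Δ.pts i.castSucc) (m (Δ.pts i.castSucc)))),
      ∃ μ : C(Time T, P2 (Torus d)), IsFlow f (Δ.pts i.castSucc) (m (Δ.pts i.castSucc)) κ μ ∧
        ∀ t, Δ.pts i.castSucc ≤ t → t ≤ Δ.pts i.succ → m t = μ t}

/-- The outcome guaranteed to the first player. -/
def J1 (f : Time T → Torus d → P2 (Torus d) → U → V → EuclideanSpace ℝ (Fin d))
    (g : P2 (Torus d) → ℝ) (t₀ : Time T) (m₀ : P2 (Torus d)) (𝔲 : Strategy T d U)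
    (Δ : Partition t₀) : EReal :=
  ⨆ m ∈ X1 f t₀ m₀ 𝔲 Δ, (g (m (endTime T)) : EReal)

/-- The outcome guaranteed to the second player. -/
def J2 (f : Time T → Torus d → P2 (Torus d) → U → V → EuclideanSpace ℝ (Fin d))
    (g : P2 (Torus d) → ℝ) (t₀ : Time T) (m₀ : P2 (Torus d)) (𝔳 : Strategy T d V)
    (Δ : Partition t₀) : EReal :=
  ⨅ m ∈ X2 f t₀ m₀ 𝔳 Δ, (g (m (endTime T)) : EReal)

/-- The upper value of the game. -/
def upperValue (f : Time T → Torus d → P2 (Torus d) → U → V → EuclideanSpace ℝ (Fin d))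
    (g : P2 (Torus d) → ℝ) (t₀ : Time T) (m₀ : P2 (Torus d)) : EReal :=
  ⨅ (𝔲 : Strategy T d U) (Δ : Partition t₀), J1 f g t₀ m₀ 𝔲 Δ

/-- The lower value of the game. -/
def lowerValue (f : Time T → Torus d → P2 (Torus d) → U → V → EuclideanSpace ℝ (Fin d))
    (g : P2 (Torus d) → ℝ) (t₀ : Time T) (m₀ : P2 (Torus d)) : EReal :=
  ⨆ (𝔳 : Strategy T d V) (Δ : Partition t₀), J2 f g t₀ m₀ 𝔳 Δ

/-! ### Stability -/

/-- `u`-stable functions. -/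
structure UStable (f : Time T → Torus d → P2 (Torus d) → U → V → EuclideanSpace ℝ (Fin d))
    (g : P2 (Torus d) → ℝ) (ψ : Time T → P2 (Torus d) → ℝ) : Prop where
  lsc : LowerSemicontinuous fun p : Time T × P2 (Torus d) => ψ p.1 p.2
  terminal : ∀ m, g m ≤ ψ (endTime T) m
  stable : ∀ s r : Time T, s < r → ∀ (mStar : P2 (Torus d)) (β : WM (Torus d) V),
    ∃ κ ∈ D2 (U := U) (constToRelaxed (T := T) β), ∃ m : C(Time T, P2 (Torus d)),
      IsFlow f s mStar κ m ∧ ψ r (m r) ≤ ψ s mStar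

/-- `v`-stable functions. -/
structure VStable (f : Time T → Torus d → P2 (Torus d) → U → V → EuclideanSpace ℝ (Fin d))
    (g : P2 (Torus d) → ℝ) (ψ : Time T → P2 (Torus d) → ℝ) : Prop where
  usc : UpperSemicontinuous fun p : Time T × P2 (Torus d) => ψ p.1 p.2
  terminal : ∀ m, ψ (endTime T) m ≤ g m
  stable : ∀ s r : Time T, s < r → ∀ (mStar : P2 (Torus d)) (α : WM (Torus d) U),
    ∃ κ ∈ D1 (V := V) (constToRelaxed (T := T) α), ∃ m : C(Time T, P2 (Torus d)),
      IsFlow f s mStar κ m ∧ ψ s mStar ≤ ψ r (m r)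

end Dynamics

end

end MeanFieldGame

open MeanFieldGame

set_option linter.unusedSectionVars false

/-! The argument is extremal aiming in the sense of Krasovskii and Subbotin, carried out on
transport plans. The real flow m is compared with a guide ν along which ψ₁ does not increase. A plan
π couples the two positions. For a pair (x, y) the first player takes u nearly optimal in the local
game whose direction w is the shortest representative of x - y, and the guide is subjected to a v
nearly optimal in the same game. By the Isaacs condition the two guarantees nearly cancel, so to
first order |x - y|² grows only through Lipschitz terms and small errors, whatever the two remaining
controls do. Disintegrating the laws of (x, u) and (y, v) under π gives the player's distribution α
and a distribution β, to which stability answers with the next guide position.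
`Dynamics.exists_extremal_shift` is the resulting estimate: a step of length δ turns the cost of π
into at most (1 + 4Lδ) cost π plus δ times a small error.

`Dynamics.exists_strategy` iterates this. The guide need not be remembered: the invariant only says
that some guide exists, with ψ₁ not above its initial value and with a plan of small cost, so a
strategy depending on the position alone suffices. A discrete Gronwall estimate keeps the cost small
up to T, where `exists_cost_modulus` turns small cost into closeness of the values of g. Neither
optimal plans nor the triangle inequality for `W2` are used: every estimate concerns the cost of an
explicit plan, together with W2² ≤ cost.

The assertion on ψ₂ is the assertion on ψ₁ for the game with the players exchanged and with g and ψ₂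
negated. -/

namespace MeanFieldGame

noncomputable section

/-! ### Centred representatives on the torus -/

section Torus

variable {d : ℕ}

/-- The representative of a vector modulo `ℤ^d` in the cube centred at the origin. -/
def centred (x : EuclideanSpace ℝ (Fin d)) : EuclideanSpace ℝ (Fin d) :=
  WithLp.toLp 2 fun i => x i - round (x i)

lemma centred_apply (x : EuclideanSpace ℝ (Fin d)) (i : Fin d) :
    centred x i = x i - round (x i) := rfl

lemma measurable_centred : Measurable (centred : EuclideanSpace ℝ (Fin d) → _) := by
  refine (WithLp.measurable_toLp 2 _).comp (measurable_pi_lambda _ fun i => ?_)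
  have h : Measurable fun x : EuclideanSpace ℝ (Fin d) => x i := by fun_prop
  have hr : Measurable fun y : ℝ => (round y : ℝ) := by
    simp only [round_eq]
    exact (measurable_from_top (f := fun k : ℤ => (k : ℝ))).comp
      (Int.measurable_floor.comp (measurable_id.add_const _))
  exact h.sub (hr.comp h)

lemma norm_centred_le (x : EuclideanSpace ℝ (Fin d)) : ‖centred x‖ ≤ ‖x‖ := by
  rw [EuclideanSpace.norm_eq, EuclideanSpace.norm_eq]
  refine Real.sqrt_le_sqrt (Finset.sum_le_sum fun i _ => ?_)
  have h : |x i - round (x i)| ≤ |x i| := by simpa using round_le (x i) 0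
  simpa [centred_apply, Real.norm_eq_abs] using pow_le_pow_left₀ (abs_nonneg _) h 2

lemma norm_centred_le_sqrt (x : EuclideanSpace ℝ (Fin d)) : ‖centred x‖ ≤ √d := by
  rw [EuclideanSpace.norm_eq]
  refine Real.sqrt_le_sqrt ?_
  calc ∑ i, ‖centred x i‖ ^ 2 ≤ ∑ _i : Fin d, (1 : ℝ) := by
        refine Finset.sum_le_sum fun i _ => pow_le_one₀ (norm_nonneg _) ?_
        rw [centred_apply, Real.norm_eq_abs]
        exact (abs_sub_round _).trans (by norm_num)
    _ = d := by simp

lemma centred_eq_of_sub_mem {x y : EuclideanSpace ℝ (Fin d)} (h : -x + y ∈ intLattice d) :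
    centred x = centred y := by
  ext i
  obtain ⟨k, hk⟩ := h i
  have hy : y i = x i + k := by rw [hk]; simp
  rw [centred_apply, centred_apply, hy, round_add_intCast]
  push_cast
  ring

/-- A measurable choice of the shortest representative of a point of the torus. -/
def Torus.lift (z : Torus d) : EuclideanSpace ℝ (Fin d) :=
  Quotient.liftOn' z centred fun _ _ h => centred_eq_of_sub_mem (QuotientAddGroup.leftRel_apply.1 h)

lemma Torus.lift_mk (x : EuclideanSpace ℝ (Fin d)) :
    Torus.lift (QuotientAddGroup.mk x : Torus d) = centred x := rfl

/-- The direction of the extremal shift is the lift of x - y, and the controls chosen from it must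
be measurable in (x, y). -/
lemma Torus.measurable_lift : Measurable (Torus.lift : Torus d → _) :=
  measurable_from_quotient.2 measurable_centred

lemma Torus.mk_lift (z : Torus d) : (QuotientAddGroup.mk (Torus.lift z) : Torus d) = z := by
  obtain ⟨x, rfl⟩ := QuotientAddGroup.mk_surjective z
  rw [Torus.lift_mk, QuotientAddGroup.eq]
  intro i
  exact ⟨round (x i), by simp [centred_apply]⟩

lemma Torus.norm_mk_le (x : EuclideanSpace ℝ (Fin d)) :
    ‖(QuotientAddGroup.mk x : Torus d)‖ ≤ ‖x‖ := QuotientAddGroup.norm_mk_le_norm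

/-- The quotient norm is an infimum over representatives, and centring does not lengthen any of
them. -/
lemma Torus.norm_lift (z : Torus d) : ‖Torus.lift z‖ = ‖z‖ := by
  refine le_antisymm ?_ ?_
  · refine le_of_forall_pos_lt_add fun ε hε => ?_
    obtain ⟨x, rfl, hx⟩ := QuotientAddGroup.exists_norm_mk_lt z hε
    exact (norm_centred_le x).trans_lt hx
  · conv_lhs => rw [← Torus.mk_lift z]
    exact Torus.norm_mk_le _

lemma Torus.continuous_mk : Continuous (QuotientAddGroup.mk : _ → Torus d) :=
  continuous_quot_mk

instance : CompactSpace (Torus d) := by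
  refine ⟨?_⟩
  have h : (Set.univ : Set (Torus d)) =
      QuotientAddGroup.mk '' Metric.closedBall (0 : EuclideanSpace ℝ (Fin d)) (√d) := by
    symm
    rw [Set.eq_univ_iff_forall]
    intro z
    refine ⟨Torus.lift z, ?_, Torus.mk_lift z⟩
    obtain ⟨x, rfl⟩ := QuotientAddGroup.mk_surjective z
    rw [mem_closedBall_zero_iff, Torus.lift_mk]
    exact norm_centred_le_sqrt x
  rw [h]
  exact (isCompact_closedBall _ _).image Torus.continuous_mk

lemma Torus.norm_le (z : Torus d) : ‖z‖ ≤ √d := by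
  obtain ⟨x, rfl⟩ := QuotientAddGroup.mk_surjective z
  rw [← Torus.norm_lift, Torus.lift_mk]
  exact norm_centred_le_sqrt x

end Torus

/-! ### Transport plans on a compact metric space -/

section Plans

variable {X : Type*} [MetricSpace X] [CompactSpace X] [MeasurableSpace X] [BorelSpace X]

/-- The quadratic cost of a transport plan. -/
def cost (π : Measure (X × X)) : ℝ := ∫ p, dist p.1 p.2 ^ 2 ∂π

lemma cost_nonneg (π : Measure (X × X)) : 0 ≤ cost π :=
  integral_nonneg fun _ => sq_nonneg _

lemma integrable_of_continuous {Y E : Type*} [TopologicalSpace Y] [CompactSpace Y]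
    [MeasurableSpace Y] [OpensMeasurableSpace Y] [NormedAddCommGroup E]
    [SecondCountableTopologyEither Y E]
    {μ : Measure Y} [IsFiniteMeasure μ] {h : Y → E} (hh : Continuous h) : Integrable h μ := by
  obtain ⟨C, hC⟩ := isCompact_univ.exists_bound_of_continuousOn hh.continuousOn
  exact Integrable.of_bound hh.aestronglyMeasurable C (ae_of_all _ fun y => hC y (Set.mem_univ _))

lemma isProbabilityMeasure_of_map {Y Z : Type*} [MeasurableSpace Y] [MeasurableSpace Z]
    {μ : Measure Y} {h : Y → Z} (hh : Measurable h) [H : IsProbabilityMeasure (μ.map h)] :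
    IsProbabilityMeasure μ :=
  ⟨by rw [← H.measure_univ, Measure.map_apply hh MeasurableSet.univ, Set.preimage_univ]⟩

lemma isProbabilityMeasure_of_mem_plans {m : Measure X} {m' : Measure X} [IsProbabilityMeasure m]
    {π : Measure (X × X)} (hπ : π ∈ plans m m') : IsProbabilityMeasure π := by
  have : IsProbabilityMeasure (π.map Prod.fst) := by rw [hπ.1]; infer_instance
  exact isProbabilityMeasure_of_map measurable_fst

lemma lintegral_edist_sq (π : Measure (X × X)) [IsFiniteMeasure π] :
    ∫⁻ p, edist p.1 p.2 ^ 2 ∂π = ENNReal.ofReal (cost π) := by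
  rw [cost, ofReal_integral_eq_lintegral_ofReal (integrable_of_continuous (by fun_prop))
    (ae_of_all _ fun _ => sq_nonneg _)]
  refine lintegral_congr fun p => ?_
  rw [edist_dist, ENNReal.ofReal_pow dist_nonneg]

lemma W2_sq_le_cost {m m' : P2 X} {π : Measure (X × X)} (hπ : π ∈ plans m.meas m'.meas) :
    W2 m m' ^ 2 ≤ cost π := by
  have := isProbabilityMeasure_of_mem_plans hπ
  rw [W2, Real.sq_sqrt ENNReal.toReal_nonneg]
  refine ENNReal.toReal_le_of_le_ofReal (cost_nonneg π) ?_
  rw [← lintegral_edist_sq]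
  exact iInf₂_le π hπ

lemma W2_nonneg (m m' : P2 X) : 0 ≤ W2 m m' := Real.sqrt_nonneg _

lemma swap_mem_plans {m m' : Measure X} {π : Measure (X × X)} (hπ : π ∈ plans m m') :
    π.map Prod.swap ∈ plans m' m := by
  constructor
  · rw [Measure.map_map measurable_fst measurable_swap]
    exact hπ.2
  · rw [Measure.map_map measurable_snd measurable_swap]
    exact hπ.1

lemma cost_swap (π : Measure (X × X)) : cost (π.map Prod.swap) = cost π := by
  rw [cost, integral_map measurable_swap.aemeasurable
    (by fun_prop : Continuous fun p : X × X => dist p.1 p.2 ^ 2).aestronglyMeasurable]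
  simp only [Prod.fst_swap, Prod.snd_swap, cost, dist_comm]

lemma W2_sq_le_cost' {m m' : P2 X} {π : Measure (X × X)} (hπ : π ∈ plans m.meas m'.meas) :
    W2 m' m ^ 2 ≤ cost π := by
  rw [← cost_swap]
  exact W2_sq_le_cost (swap_mem_plans hπ)

lemma diagonal_mem_plans (m : Measure X) : m.map (fun x => (x, x)) ∈ plans m m := by
  constructor
  · rw [Measure.map_map measurable_fst (by fun_prop)]
    exact Measure.map_id
  · rw [Measure.map_map measurable_snd (by fun_prop)]
    exact Measure.map_id

lemma cost_diagonal (m : Measure X) : cost (m.map fun x => (x, x)) = 0 := by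
  rw [cost, integral_map (by fun_prop)
    (by fun_prop : Continuous fun p : X × X => dist p.1 p.2 ^ 2).aestronglyMeasurable]
  simp

/-- A plan between probabilities whose integrals over the members of a partition of unity are
close: inside the supports mass is moved over short distances, the rest is moved arbitrarily. -/
lemma exists_plan_of_partition {ι : Type*} [Fintype ι] (φ : ι → X → ℝ)
    (hφ : ∀ j, Continuous (φ j)) (h0 : ∀ j x, 0 ≤ φ j x) (h1 : ∀ x, ∑ j, φ j x = 1)
    {R D ε : ℝ} (hε1 : ε ≤ 1) (hR : 0 ≤ R)
    (hsupp : ∀ j x x', φ j x ≠ 0 → φ j x' ≠ 0 → dist x x' ^ 2 ≤ R)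
    (hD : ∀ x x' : X, dist x x' ^ 2 ≤ D)
    (m m' : Measure X) [IsProbabilityMeasure m] [IsProbabilityMeasure m']
    (hclose : ∀ j, (1 - ε) * ∫ x, φ j x ∂m ≤ ∫ x, φ j x ∂m')
    (hpos : ∀ j, ∫ x, φ j x ∂m' = 0 → ∫ x, φ j x ∂m = 0) :
    ∃ π ∈ plans m m', cost π ≤ R + D * ε := by
  have hint : ∀ (μ : Measure X) [IsProbabilityMeasure μ] j, Integrable (φ j) μ :=
    fun μ _ j => integrable_of_continuous (hφ j)
  set a : ι → ℝ := fun j => ∫ x, φ j x ∂m with ha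
  set b : ι → ℝ := fun j => ∫ x, φ j x ∂m' with hb
  have hb0 : ∀ j, 0 ≤ b j := fun j => integral_nonneg (h0 j)
  have hsum : ∀ (μ : Measure X) [IsProbabilityMeasure μ], ∑ j, ∫ x, φ j x ∂μ = 1 := by
    intro μ _
    rw [← integral_finsetSum _ fun j _ => hint μ j]
    simp [h1]
  set c : ι → ℝ := fun j => 1 - (1 - ε) * a j / b j with hc
  have hc0 : ∀ j, 0 ≤ c j := by
    intro j
    have : (1 - ε) * a j / b j ≤ 1 := div_le_one_of_le₀ (hclose j) (hb0 j)
    simp only [hc]; linarith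
  have hbc : ∀ j, b j * c j = b j - (1 - ε) * a j := by
    intro j
    rcases eq_or_ne (b j) 0 with h | h
    · have : a j = 0 := hpos j h
      simp [h, this]
    · simp only [hc]; field_simp
  -- Density of the plan with respect to m ⊗ m'. The first term moves mass inside a single support.
  -- The constant c j makes the x-integral of the j-th summand equal to φ j x', and spreads the
  -- remaining mass ε without regard to distance.
  set k : X × X → ℝ := fun p => ∑ j, φ j p.2 * ((1 - ε) * φ j p.1 / b j + c j) with hk
  have hk0 : ∀ p, 0 ≤ k p := fun p => Finset.sum_nonneg fun j _ => mul_nonneg (h0 j _)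
    (add_nonneg (div_nonneg (mul_nonneg (by linarith) (h0 j _)) (hb0 j)) (hc0 j))
  have hkc : Continuous k := by
    refine continuous_finsetSum _ fun j _ => ?_
    have := hφ j
    fun_prop
  have hfst : ∀ᵐ x ∂m, ∫ x', k (x, x') ∂m' = 1 := by
    -- If b j = 0, the quotient is 0 by convention and the term (1 - ε) φ j x is lost. This is
    -- harmless: then a j = 0, so φ j vanishes m-almost everywhere.
    have hz : ∀ j, ∀ᵐ x ∂m, a j = 0 → φ j x = 0 := by
      intro j
      by_cases h : a j = 0
      · have := (integral_eq_zero_iff_of_nonneg (h0 j) (hint m j)).1 h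
        filter_upwards [this] with x hx _ using hx
      · exact ae_of_all _ fun x hx => absurd hx h
    filter_upwards [ae_all_iff.2 hz] with x hx
    have : ∀ j, b j * ((1 - ε) * φ j x / b j + c j) = (1 - ε) * φ j x + (b j - (1 - ε) * a j) := by
      intro j
      rw [mul_add, hbc]
      rcases eq_or_ne (b j) 0 with h | h
      · simp [h, hx j (hpos j h)]
      · field_simp
    simp only [hk]
    rw [integral_finsetSum _ fun j _ => (hint m' j).mul_const _]
    simp only [integral_mul_const]
    rw [Finset.sum_congr rfl fun j _ => this j, Finset.sum_add_distrib, Finset.sum_sub_distrib,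
      ← Finset.mul_sum, ← Finset.mul_sum, h1, hsum m', hsum m]
    ring
  have hsnd : ∀ x', ∫ x, k (x, x') ∂m = 1 := by
    intro x'
    simp only [hk]
    rw [integral_finsetSum _ fun j _ => integrable_of_continuous (by have := hφ j; fun_prop)]
    trans ∑ j, φ j x'
    swap
    · exact h1 x'
    refine Finset.sum_congr rfl fun j _ => ?_
    rw [integral_const_mul, integral_add (((hint m j).const_mul _).div_const _)
      (integrable_const _), integral_div, integral_const_mul]
    simp only [integral_const, probReal_univ, one_smul, hc]
    change φ j x' * ((1 - ε) * a j / b j + (1 - (1 - ε) * a j / b j)) = _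
    ring
  have hkm : Measurable fun p => ENNReal.ofReal (k p) := hkc.measurable.ennreal_ofReal
  have key : ∀ (μ : Measure X) [IsProbabilityMeasure μ] (h : X → X × X), Continuous h →
      ∫ x, k (h x) ∂μ = 1 → ∫⁻ x, ENNReal.ofReal (k (h x)) ∂μ = 1 := by
    intro μ _ h hh h1
    have hi : Integrable (fun x => k (h x)) μ := integrable_of_continuous (hkc.comp hh)
    rw [← ofReal_integral_eq_lintegral_ofReal hi (ae_of_all _ fun _ => hk0 _), h1,
      ENNReal.ofReal_one]
  have hπ : (m.prod m').withDensity (fun p => ENNReal.ofReal (k p)) ∈ plans m m' := by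
    constructor
    · refine Measure.ext_of_lintegral _ fun F hF => ?_
      rw [lintegral_map hF measurable_fst, lintegral_withDensity_eq_lintegral_mul _ hkm
        (by fun_prop : Measurable fun p : X × X => F p.1),
        lintegral_prod _ (by fun_prop)]
      refine lintegral_congr_ae ?_
      filter_upwards [hfst] with x hx
      simp only [Pi.mul_apply]
      rw [lintegral_mul_const _ (by fun_prop : Measurable fun x' => ENNReal.ofReal (k (x, x'))),
        key m' (fun x' => (x, x')) (by fun_prop) hx, one_mul]
    · refine Measure.ext_of_lintegral _ fun F hF => ?_
      rw [lintegral_map hF measurable_snd, lintegral_withDensity_eq_lintegral_mul _ hkm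
        (by fun_prop : Measurable fun p : X × X => F p.2),
        lintegral_prod_symm _ (by fun_prop)]
      refine lintegral_congr fun x' => ?_
      simp only [Pi.mul_apply]
      rw [lintegral_mul_const _ (by fun_prop : Measurable fun x => ENNReal.ofReal (k (x, x'))),
        key m (fun x => (x, x')) (by fun_prop) (hsnd x'), one_mul]
  refine ⟨_, hπ, ?_⟩
  have hbound : ∀ p : X × X, k p * dist p.1 p.2 ^ 2 ≤ R * k p + D * ∑ j, φ j p.2 * c j := by
    intro p
    simp only [hk, Finset.sum_mul, Finset.mul_sum]
    rw [← Finset.sum_add_distrib]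
    refine Finset.sum_le_sum fun j _ => ?_
    have e1 : φ j p.2 * ((1 - ε) * φ j p.1 / b j) * dist p.1 p.2 ^ 2
        ≤ φ j p.2 * ((1 - ε) * φ j p.1 / b j) * R := by
      by_cases h2 : φ j p.2 = 0
      · simp [h2]
      by_cases h3 : φ j p.1 = 0
      · simp [h3]
      exact mul_le_mul_of_nonneg_left (hsupp j _ _ h3 h2) (mul_nonneg (h0 j _)
        (div_nonneg (mul_nonneg (by linarith) (h0 j _)) (hb0 j)))
    have e2 : φ j p.2 * c j * dist p.1 p.2 ^ 2 ≤ φ j p.2 * c j * D :=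
      mul_le_mul_of_nonneg_left (hD _ _) (mul_nonneg (h0 j _) (hc0 j))
    have e3 : 0 ≤ R * (φ j p.2 * c j) := mul_nonneg hR (mul_nonneg (h0 j _) (hc0 j))
    nlinarith
  have hcost : cost ((m.prod m').withDensity fun p => ENNReal.ofReal (k p))
      = ∫ p, k p * dist p.1 p.2 ^ 2 ∂(m.prod m') := by
    rw [cost, integral_withDensity_eq_integral_toReal_smul hkm (ae_of_all _ fun _ => by simp)]
    refine integral_congr_ae (ae_of_all _ fun p => ?_)
    simp [ENNReal.toReal_ofReal (hk0 p)]
  rw [hcost]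
  have hc' : Continuous fun p : X × X => ∑ j, φ j p.2 * c j := by
    refine continuous_finsetSum _ fun j _ => ?_
    have := hφ j
    fun_prop
  calc ∫ p, k p * dist p.1 p.2 ^ 2 ∂(m.prod m')
      ≤ ∫ p, (R * k p + D * ∑ j, φ j p.2 * c j) ∂(m.prod m') := by
        refine integral_mono (integrable_of_continuous (by fun_prop))
          (integrable_of_continuous (by fun_prop)) hbound
    _ = R * ∫ p, k p ∂(m.prod m') + D * ∫ p, ∑ j, φ j p.2 * c j ∂(m.prod m') := by
        rw [integral_add (integrable_of_continuous (by fun_prop))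
          (integrable_of_continuous (by fun_prop)), integral_const_mul, integral_const_mul]
    _ = R + D * ε := by
        rw [integral_prod_symm _ (integrable_of_continuous hkc),
          integral_prod_symm _ (integrable_of_continuous hc')]
        simp only [hsnd, integral_const, probReal_univ, one_smul]
        rw [integral_finsetSum _ fun j _ => (hint m' j).mul_const _]
        simp only [integral_mul_const]
        have : ∑ j, (∫ x, φ j x ∂m') * c j = ε := by
          rw [Finset.sum_congr rfl fun j _ => hbc j, Finset.sum_sub_distrib, ← Finset.mul_sum,
            hsum m', hsum m]
          ring
        rw [this, mul_one]

/-- A finite continuous partition of unity with small supports. -/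
lemma exists_partition_small {R : ℝ} (hR : 0 < R) :
    ∃ (n : ℕ) (φ : Fin n → C(X, ℝ)), (∀ j x, 0 ≤ φ j x) ∧ (∀ x, ∑ j, φ j x = 1) ∧
      ∀ j x x', φ j x ≠ 0 → φ j x' ≠ 0 → dist x x' ≤ R := by
  obtain ⟨t, -, ht, hcov⟩ := finite_cover_balls_of_compact (isCompact_univ (X := X)) (half_pos hR)
  have := ht.fintype
  let e := Fintype.equivFin t
  obtain ⟨φ, hs, h1, h0, -⟩ := exists_continuous_sum_one_of_isOpen_isCompact
    (s := fun i => Metric.ball (e.symm i : X) (R / 2)) (fun i => Metric.isOpen_ball)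
    (isCompact_univ (X := X)) (by
      intro x hx
      obtain ⟨y, hy, hxy⟩ := Set.mem_iUnion₂.1 (hcov hx)
      exact Set.mem_iUnion.2 ⟨e ⟨y, hy⟩, by simpa using hxy⟩)
  refine ⟨_, φ, fun j x => (h0 j x).1, fun x => by simpa using h1 (Set.mem_univ x), ?_⟩
  intro j x x' hx hx'
  have h2 := hs j (subset_tsupport _ hx)
  have h3 := hs j (subset_tsupport _ hx')
  rw [Metric.mem_ball] at h2 h3
  linarith [dist_triangle_right x x' (e.symm j : X)]

/-- Narrow closeness controls the finitely many integrals of a partition of unity. The closeness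
required is multiplicative, hence trivial where the integral is 0 and an open condition elsewhere.
Supports of diameter at most √(r/4) and |D| ε ≤ r/4 leave a cost of at most r/2. -/
lemma eventually_exists_plan (m : ProbabilityMeasure X) {r : ℝ} (hr : 0 < r) :
    ∀ᶠ m' : ProbabilityMeasure X in 𝓝 m, ∃ π ∈ plans (m : Measure X) (m' : Measure X), cost π < r := by
  obtain ⟨D, hD⟩ := isCompact_univ.exists_bound_of_continuousOn
    (f := fun p : X × X => dist p.1 p.2 ^ 2) (by fun_prop)
  have hD' : ∀ x x' : X, dist x x' ^ 2 ≤ |D| := fun x x' =>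
    (le_abs_self _).trans ((hD (x, x') (Set.mem_univ _)).trans (le_abs_self _))
  set ε : ℝ := min 1 (r / (4 * (|D| + 1))) with hε
  have hε0 : 0 < ε := by positivity
  obtain ⟨n, φ, h0, h1, hs⟩ := exists_partition_small (X := X) (R := √(r / 4)) (by positivity)
  have hev : ∀ j, ∀ᶠ m' : ProbabilityMeasure X in 𝓝 m,
      (1 - ε) * ∫ x, φ j x ∂(m : Measure X) ≤ ∫ x, φ j x ∂(m' : Measure X) ∧
      (∫ x, φ j x ∂(m' : Measure X) = 0 → ∫ x, φ j x ∂(m : Measure X) = 0) := by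
    intro j
    have hm : 0 ≤ ∫ x, φ j x ∂(m : Measure X) := integral_nonneg (h0 j)
    rcases hm.eq_or_lt with h | h
    · refine Eventually.of_forall fun m' => ⟨?_, fun _ => h.symm⟩
      rw [← h, mul_zero]
      exact integral_nonneg (h0 j)
    · have hc := (ProbabilityMeasure.continuous_integral_boundedContinuousFunction
        (BoundedContinuousFunction.mkOfCompact (φ j))).tendsto m
      have hlt : (1 - ε) * ∫ x, φ j x ∂(m : Measure X) < ∫ x, φ j x ∂(m : Measure X) := by
        nlinarith
      filter_upwards [hc.eventually (lt_mem_nhds hlt), hc.eventually (lt_mem_nhds h)]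
        with m' h2 h3
      exact ⟨h2.le, fun h4 => absurd h4 h3.ne'⟩
  filter_upwards [eventually_all.2 hev] with m' hm'
  obtain ⟨π, hπ, hc⟩ := exists_plan_of_partition (fun j => φ j) (fun j => (φ j).continuous) h0 h1
    (min_le_left _ _) (R := r / 4) (by positivity)
    (fun j x x' hx hx' => (pow_le_pow_left₀ dist_nonneg (hs j x x' hx hx') 2).trans
      (Real.sq_sqrt (by positivity)).le) hD' m m' (fun j => (hm' j).1) (fun j => (hm' j).2)
  refine ⟨π, hπ, hc.trans_lt ?_⟩
  have h5 : ε * (4 * (|D| + 1)) ≤ r := by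
    rw [← le_div_iff₀ (by positivity)]
    exact min_le_right _ _
  nlinarith [abs_nonneg D]

/-- A Borel probability on a compact metric space, as a point of the Wasserstein space. -/
def toP2 (m : ProbabilityMeasure X) : P2 X :=
  ⟨m, m.2, by
    obtain ⟨a⟩ := (m : Measure X).nonempty_of_neZero
    obtain ⟨D, hD⟩ := isCompact_univ.exists_bound_of_continuousOn
      (f := fun x : X => dist x a) (by fun_prop)
    refine ⟨a, lt_of_le_of_lt (lintegral_mono (g := fun _ => ENNReal.ofReal D ^ 2) fun x => ?_) ?_⟩
    · rw [edist_dist]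
      exact pow_le_pow_left' (ENNReal.ofReal_le_ofReal
        ((le_abs_self _).trans (hD x (Set.mem_univ _)))) 2
    · simp⟩

/-- This direction of the comparison of topologies suffices: it carries narrow compactness over to
`P2 X` and makes functions continuous for `W2` narrowly continuous. -/
lemma continuous_toP2 : Continuous (toP2 : ProbabilityMeasure X → P2 X) := by
  refine continuous_def.2 fun S hS => isOpen_iff_mem_nhds.2 fun m hm => ?_
  obtain ⟨ε, hε, h⟩ := hS (toP2 m) hm
  filter_upwards [eventually_exists_plan m (pow_pos hε 2)] with m' hm'
  obtain ⟨π, hπ, hc⟩ := hm'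
  exact h _ (lt_of_pow_lt_pow_left₀ 2 hε.le ((W2_sq_le_cost hπ).trans_lt hc))

lemma toP2_surjective : Function.Surjective (toP2 : ProbabilityMeasure X → P2 X) :=
  fun m => ⟨⟨m.1, m.2.1⟩, rfl⟩

instance : CompactSpace (P2 X) := by
  refine ⟨?_⟩
  rw [← toP2_surjective.range_eq]
  exact isCompact_range continuous_toP2

/-- Plans whose marginals violate the inequality form a narrowly compact set, on which the cost
attains its minimum. The minimum is positive, since a plan of zero cost lives on the diagonal and
has equal marginals. -/
lemma exists_cost_modulus {g : P2 X → ℝ} (hg : Continuous g) {ε : ℝ} (hε : 0 < ε) :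
    ∃ ρ > 0, ∀ (m m' : P2 X), ∀ π ∈ plans m.meas m'.meas, cost π < ρ → g m < g m' + ε := by
  let M1 : ProbabilityMeasure (X × X) → ProbabilityMeasure X :=
    fun π => π.map measurable_fst.aemeasurable
  let M2 : ProbabilityMeasure (X × X) → ProbabilityMeasure X :=
    fun π => π.map measurable_snd.aemeasurable
  have hM1 : Continuous M1 := ProbabilityMeasure.continuous_map continuous_fst
  have hM2 : Continuous M2 := ProbabilityMeasure.continuous_map continuous_snd
  let h : ProbabilityMeasure (X × X) → ℝ := fun π => g (toP2 (M1 π)) - g (toP2 (M2 π))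
  have hh : Continuous h := (hg.comp (continuous_toP2.comp hM1)).sub
    (hg.comp (continuous_toP2.comp hM2))
  have hcost : Continuous fun π : ProbabilityMeasure (X × X) => cost (π : Measure (X × X)) := by
    let F : C(X × X, ℝ) := ⟨fun p => dist p.1 p.2 ^ 2, by fun_prop⟩
    exact ProbabilityMeasure.continuous_integral_boundedContinuousFunction
      (BoundedContinuousFunction.mkOfCompact F)
  have hK : IsCompact {π | ε ≤ h π} := (isClosed_le continuous_const hh).isCompact
  have hfin : ∀ ρ : ℝ, (∀ π, ε ≤ h π → ρ ≤ cost (π : Measure (X × X))) →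
      ∀ (m m' : P2 X), ∀ π ∈ plans m.meas m'.meas, cost π < ρ → g m < g m' + ε := by
    intro ρ hρ m m' π hπ hc
    by_contra! hcon
    let π' : ProbabilityMeasure (X × X) := ⟨π, isProbabilityMeasure_of_mem_plans hπ⟩
    have e1 : toP2 (M1 π') = m := Subtype.ext hπ.1
    have e2 : toP2 (M2 π') = m' := Subtype.ext hπ.2
    have := hρ π' (by simp only [h, e1, e2]; linarith)
    exact absurd hc (not_lt.2 this)
  rcases Set.eq_empty_or_nonempty {π | ε ≤ h π} with he | hne
  · exact ⟨1, one_pos, hfin 1 fun π hπ => absurd hπ (Set.eq_empty_iff_forall_notMem.1 he π)⟩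
  · obtain ⟨π₀, hπ₀, hmin⟩ := hK.exists_isMinOn hne hcost.continuousOn
    refine ⟨cost (π₀ : Measure (X × X)), (cost_nonneg _).lt_of_ne' fun h0 => ?_,
      hfin _ fun π hπ => hmin hπ⟩
    have hae := (integral_eq_zero_iff_of_nonneg (fun _ => sq_nonneg _)
      (integrable_of_continuous
        (by fun_prop : Continuous fun p : X × X => dist p.1 p.2 ^ 2))).1 h0
    have heq : M1 π₀ = M2 π₀ := by
      refine Subtype.ext (Measure.map_congr ?_)
      filter_upwards [hae] with p hp
      simpa using hp
    have : ε ≤ h π₀ := hπ₀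
    simp only [h, heq, sub_self] at this
    linarith

end Plans

/-! ### Existence of motions -/

section Existence

variable {T : ℝ≥0}

lemma map_volume_time :
    (volume : Measure (Time T)).map ((↑) : Time T → ℝ) = volume.restrict (Set.Icc 0 (T : ℝ)) :=
  map_comap_subtype_coe measurableSet_Icc _

lemma setIntegral_time {E : Type*} [NormedAddCommGroup E] [NormedSpace ℝ E]
    (h : Time T → E) (s t : Time T) :
    ∫ τ in Set.Ioc s t, h τ = ∫ τ in Set.Ioc (s : ℝ) t, h (Set.projIcc 0 (T : ℝ) T.coe_nonneg τ) := by
  have e := (MeasurableEmbedding.subtype_coe (measurableSet_Icc (a := (0 : ℝ)) (b := T))).setIntegral_map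
    (μ := volume) (fun τ => h (Set.projIcc 0 (T : ℝ) T.coe_nonneg τ)) (Set.Ioc (s : ℝ) t)
  have h1 : Measure.map ((↑) : Time T → ℝ) volume = volume.restrict (Set.Icc 0 (T : ℝ)) :=
    map_volume_time
  rw [h1, Measure.restrict_restrict measurableSet_Ioc,
    Set.inter_eq_self_of_subset_left
      (Set.Ioc_subset_Icc_self.trans (Set.Icc_subset_Icc s.2.1 t.2.2))] at e
  rw [e]
  simp only [Set.projIcc_val]
  exact setIntegral_congr_set (ae_of_all _ fun _ => rfl)

lemma setIntegral_time_sub {E : Type*} [NormedAddCommGroup E] [NormedSpace ℝ E]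
    (h : Time T → E) (s t : Time T) :
    (∫ τ in Set.Ioc s t, h τ) - ∫ τ in Set.Ioc t s, h τ
      = ∫ τ in (s : ℝ)..t, h (Set.projIcc 0 (T : ℝ) T.coe_nonneg τ) := by
  rw [setIntegral_time, setIntegral_time]
  rfl

lemma volume_time_Ioc (s t : Time T) :
    volume (Set.Ioc s t) = ENNReal.ofReal ((t : ℝ) - s) := by
  have h := Measure.map_apply (μ := (volume : Measure (Time T))) measurable_subtype_coe
    (measurableSet_Ioc (a := (s : ℝ)) (b := t))
  have h1 : Measure.map ((↑) : Time T → ℝ) volume = volume.restrict (Set.Icc 0 (T : ℝ)) :=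
    map_volume_time
  rw [h1, Measure.restrict_apply measurableSet_Ioc, Set.inter_eq_self_of_subset_left
      (Set.Ioc_subset_Icc_self.trans (Set.Icc_subset_Icc s.2.1 t.2.2)), Real.volume_Ioc] at h
  rw [h]
  rfl

variable {d : ℕ}

/-- The integral equation on the torus for a bounded vector field which is Lipschitz in the
position and measurable along curves has a solution. -/
lemma exists_motion (F : Time T → Torus d → EuclideanSpace ℝ (Fin d)) {M : ℝ} {K : ℝ≥0}
    (hM : ∀ τ z, ‖F τ z‖ ≤ M) (hK : ∀ τ z z', ‖F τ z - F τ z'‖ ≤ K * dist z z')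
    (hF : ∀ x : C(Time T, Torus d), Measurable fun τ => F τ (x τ)) (s : Time T) (y : Torus d) :
    ∃ x : C(Time T, Torus d), ∀ t : Time T, x t = y + QuotientAddGroup.mk
      ((∫ τ in Set.Ioc s t, F τ (x τ)) - ∫ τ in Set.Ioc t s, F τ (x τ)) := by
  let pr : C(EuclideanSpace ℝ (Fin d), Torus d) := ⟨QuotientAddGroup.mk, Torus.continuous_mk⟩
  -- The equation is solved in ℝ^d, with the field pulled back along the projection; the projected
  -- fixed point is the motion on the torus.
  let G : C(Time T, EuclideanSpace ℝ (Fin d)) → ℝ → EuclideanSpace ℝ (Fin d) :=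
    fun z τ => F (Set.projIcc 0 (T : ℝ) T.coe_nonneg τ) (pr (z (Set.projIcc 0 (T : ℝ) T.coe_nonneg τ)))
  have hG : ∀ z a b, IntervalIntegrable (G z) volume a b := by
    intro z a b
    refine (intervalIntegrable_const (c := M)).mono_fun ?_ (ae_of_all _ fun τ => ?_)
    · exact ((hF (pr.comp z)).comp continuous_projIcc.measurable).aestronglyMeasurable
    · exact (hM _ _).trans (le_abs_self _)
  let Φ : C(Time T, EuclideanSpace ℝ (Fin d)) → C(Time T, EuclideanSpace ℝ (Fin d)) := fun z =>
    ⟨fun t => Torus.lift y + ∫ τ in (s : ℝ)..t, G z τ,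
      continuous_const.add ((intervalIntegral.continuous_primitive (hG z) s).comp
        continuous_subtype_val)⟩
  have hΦ : ∀ n z z' (t : Time T), dist ((Φ^[n] z) t) ((Φ^[n] z') t) ≤
      (K * |(t : ℝ) - s|) ^ n / n.factorial * dist z z' := by
    intro n z z'
    induction n with
    | zero => intro t; simpa using! ContinuousMap.dist_apply_le_dist (f := z) (g := z') t
    | succ n hn =>
      intro t
      rw [Function.iterate_succ_apply', Function.iterate_succ_apply']
      set a := Φ^[n] z
      set b := Φ^[n] z'
      have e : dist (Φ a t) (Φ b t) = ‖∫ τ in (s : ℝ)..t, (G a τ - G b τ)‖ := by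
        rw [intervalIntegral.integral_sub (hG _ _ _) (hG _ _ _), dist_eq_norm]
        simp [Φ]
      rw [e]
      calc ‖∫ τ in (s : ℝ)..t, (G a τ - G b τ)‖
          ≤ |∫ τ in (s : ℝ)..t, (K : ℝ) ^ (n + 1) * |τ - s| ^ n / n.factorial * dist z z'| := by
            refine intervalIntegral.norm_integral_le_abs_of_norm_le ?_
              (Continuous.intervalIntegrable (by fun_prop) _ _)
            refine (ae_restrict_mem measurableSet_Ioc).mono fun τ hτ => ?_
            have hτ' : τ ∈ Set.Icc 0 (T : ℝ) :=
              Set.uIoc_subset_uIcc.trans (Set.uIcc_subset_Icc s.2 t.2) hτ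
            have hpr : ∀ u v : EuclideanSpace ℝ (Fin d), dist (pr u) (pr v) ≤ dist u v := by
              intro u v
              rw [dist_eq_norm, dist_eq_norm]
              exact Torus.norm_mk_le (u - v)
            have h2 := hn (Set.projIcc 0 (T : ℝ) T.coe_nonneg τ)
            calc ‖G a τ - G b τ‖ ≤ K * dist (a (Set.projIcc 0 (T : ℝ) T.coe_nonneg τ))
                  (b (Set.projIcc 0 (T : ℝ) T.coe_nonneg τ)) :=
                  (hK _ _ _).trans (mul_le_mul_of_nonneg_left (hpr _ _) K.2)
              _ ≤ K * ((K * |τ - s|) ^ n / n.factorial * dist z z') := by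
                  rw [Set.projIcc_of_mem _ hτ'] at h2 ⊢
                  exact mul_le_mul_of_nonneg_left h2 K.2
              _ = (K : ℝ) ^ (n + 1) * |τ - s| ^ n / n.factorial * dist z z' := by
                  rw [mul_pow]; ring
        _ = (K * |(t : ℝ) - s|) ^ (n + 1) / (n + 1).factorial * dist z z' := by
            rw [intervalIntegral.integral_mul_const,
              intervalIntegral.integral_div, intervalIntegral.integral_const_mul, abs_mul, abs_div,
              abs_mul, intervalIntegral.abs_intervalIntegral_eq, integral_pow_abs_sub_uIoc, abs_div,
              abs_pow, abs_pow, abs_dist, NNReal.abs_eq, abs_abs, mul_div, div_div, ← abs_mul,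
              ← Nat.cast_succ, ← Nat.cast_mul, ← Nat.factorial_succ, Nat.abs_cast, ← mul_pow]
  -- Φ itself need not contract, but the factorial bound makes some iterate contract, and the fixed
  -- point of that iterate is fixed by Φ.
  obtain ⟨n, hn⟩ := (FloorSemiring.tendsto_pow_div_factorial_atTop ((K : ℝ) * T)).eventually
    (gt_mem_nhds zero_lt_one) |>.exists
  have hcontr : ContractingWith ((K * T) ^ n / n.factorial) Φ^[n] := by
    refine ⟨by exact_mod_cast hn, LipschitzWith.of_dist_le_mul fun z z' => ?_⟩
    rw [ContinuousMap.dist_le (mul_nonneg (NNReal.coe_nonneg _) dist_nonneg)]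
    intro t
    refine (hΦ n z z' t).trans ?_
    have h3 : |(t : ℝ) - s| ≤ T := by
      rw [abs_le]
      constructor <;> linarith [t.2.1, t.2.2, s.2.1, s.2.2]
    push_cast
    gcongr
  obtain ⟨z, hz⟩ : ∃ z, Φ z = z := ⟨_, hcontr.isFixedPt_fixedPoint_iterate⟩
  refine ⟨pr.comp z, fun t => ?_⟩
  rw [setIntegral_time_sub]
  have h4 := DFunLike.congr_fun hz t
  have h5 : z t = Torus.lift y + ∫ τ in (s : ℝ)..t, G z τ := h4.symm
  have h6 : (QuotientAddGroup.mk (z t) : Torus d)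
      = y + QuotientAddGroup.mk (∫ τ in (s : ℝ)..t, G z τ) := by
    rw [h5, QuotientAddGroup.mk_add, Torus.mk_lift]
  exact h6

end Existence

/-! ### Representatives of relaxed controls -/

section Representatives

variable {T : ℝ≥0} {Y Z : Type*} [MeasurableSpace Y] [MeasurableSpace Z]

lemma Relaxed.mk_rep (η : Relaxed T Y) : Relaxed.mk η.rep = η := Quotient.out_eq _

lemma Relaxed.rep_mk_ae (b : WM (Time T) Y) :
    ∀ᵐ t : Time T, (Relaxed.mk b).rep.ker t = b.ker t :=
  Quotient.exact (s := relaxedSetoid T Y) (Relaxed.mk_rep (Relaxed.mk b))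

/-- A representative is an arbitrary member of its class, so the product form is recovered only for
almost every time. This is enough under time integrals. -/
lemma Relaxed.rep_prod_ae (ξ : Relaxed T Y) (ζ : Relaxed T Z) :
    ∀ᵐ t : Time T, (ξ.prod ζ).rep.ker t = (ξ.rep.ker t).prod (ζ.rep.ker t) := by
  have h : ξ.prod ζ = Relaxed.mk ⟨ξ.rep.ker ×ₖ ζ.rep.ker, inferInstance⟩ := by
    conv_lhs => rw [← Relaxed.mk_rep ξ, ← Relaxed.mk_rep ζ]
    rfl
  rw [h]
  filter_upwards [Relaxed.rep_mk_ae (T := T) ⟨ξ.rep.ker ×ₖ ζ.rep.ker, inferInstance⟩] with t ht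
  rw [ht]
  exact Kernel.prod_apply _ _ _

lemma Relaxed.rep_const_ae (u : Y) :
    ∀ᵐ t : Time T, (Relaxed.const u : Relaxed T Y).rep.ker t = Measure.dirac u := by
  refine (Relaxed.rep_mk_ae (T := T)
    ⟨Kernel.deterministic (fun _ => u) measurable_const, inferInstance⟩).mono fun t ht => ?_
  exact ht.trans (Kernel.deterministic_apply measurable_const t)

variable [MeasurableSpace.CountablyGenerated Y]

/-- Disintegration over a countably generated space is unique almost everywhere. This makes the
narrow topology on relaxed controls Hausdorff. -/
lemma Relaxed.toMeasure_injective : Function.Injective (Relaxed.toMeasure : Relaxed T Y → _) := by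
  intro η η' h
  rw [← Relaxed.mk_rep η, ← Relaxed.mk_rep η'] at h ⊢
  exact Quotient.sound (s := relaxedSetoid T Y)
    (Kernel.ae_eq_of_compProd_eq (congrArg Subtype.val h))

end Representatives

/-! ### Recovering a control from the constant relaxed control it defines -/

section ConstantControls

variable {T : ℝ≥0} {U : Type*} [MetricSpace U] [CompactSpace U] [MeasurableSpace U] [BorelSpace U]

instance : T2Space (Relaxed T U) :=
  T2Space.of_injective_continuous Relaxed.toMeasure_injective continuous_induced_dom

lemma Relaxed.continuous_const_control : Continuous (Relaxed.const : U → Relaxed T U) := by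
  rw [continuous_induced_rng, continuous_iff_continuousAt]
  intro u
  rw [ContinuousAt, FiniteMeasure.tendsto_iff_forall_lintegral_tendsto]
  intro φ
  simp only [Function.comp_apply, Relaxed.lintegral_const_control]
  refine tendsto_lintegral_filter_of_dominated_convergence (fun _ => (nndist φ 0 : ℝ≥0∞)) ?_ ?_ ?_ ?_
  · exact Eventually.of_forall fun v =>
      (φ.continuous.measurable.comp measurable_prodMk_right).coe_nnreal_ennreal
  · refine Eventually.of_forall fun v => ae_of_all _ fun t => ?_
    exact_mod_cast BoundedContinuousFunction.NNReal.upper_bound φ (t, v)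
  · rw [lintegral_const]
    exact ENNReal.mul_ne_top ENNReal.coe_ne_top (measure_ne_top _ _)
  · refine ae_of_all _ fun t => ENNReal.tendsto_coe.2 ?_
    exact (φ.continuous.comp (by fun_prop : Continuous fun v : U => (t, v))).tendsto u

/-- The times s < r exclude T = 0, where the Lebesgue measure of [0, T] vanishes and all relaxed
controls coincide. -/
lemma Relaxed.const_injective {s r : Time T} (hsr : s < r) :
    Function.Injective (Relaxed.const : U → Relaxed T U) := by
  intro u u' h
  have hne : (volume : Measure (Time T)) ≠ 0 := by
    intro h0
    have h1 := volume_time_Ioc s r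
    rw [h0, Measure.coe_zero, Pi.zero_apply, eq_comm, ENNReal.ofReal_eq_zero] at h1
    have : (s : ℝ) < r := hsr
    linarith
  have : (ae (volume : Measure (Time T))).NeBot := ae_neBot.2 hne
  have h2 := Relaxed.rep_const_ae (T := T) u'
  rw [← h] at h2
  obtain ⟨t, h3, h4⟩ := ((Relaxed.rep_const_ae (T := T) u).and h2).exists
  exact dirac_eq_dirac_iff.1 (h3.symm.trans h4)

/-- An injective continuous map from a compact space to a Hausdorff one is a closed embedding. Hence
u can be read off measurably from its constant relaxed control. -/
lemma Relaxed.measurableEmbedding_const {s r : Time T} (hsr : s < r) :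
    MeasurableEmbedding (Relaxed.const : U → Relaxed T U) :=
  (Relaxed.continuous_const_control.isClosedEmbedding
    (Relaxed.const_injective hsr)).measurableEmbedding

end ConstantControls

/-! ### Regularity of motions -/

section Motions

variable {T : ℝ≥0} {d : ℕ} {U V : Type*}
  [MetricSpace U] [CompactSpace U] [MeasurableSpace U] [BorelSpace U]
  [MetricSpace V] [CompactSpace V] [MeasurableSpace V] [BorelSpace V]

/-- Standing assumptions on the dynamics: continuity, a bound, and Lipschitz continuity in the
state and the distribution. -/
structure Dynamics (f : Time T → Torus d → P2 (Torus d) → U → V → EuclideanSpace ℝ (Fin d))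
    (M L : ℝ≥0) : Prop where
  cont : Continuous fun p : Time T × Torus d × P2 (Torus d) × U × V =>
    f p.1 p.2.1 p.2.2.1 p.2.2.2.1 p.2.2.2.2
  bound : ∀ t x m u v, ‖f t x m u v‖ ≤ M
  lip : ∀ t x x' m m' u v, ‖f t x m u v - f t x' m' u v‖ ≤ L * dist x x' + L * W2 m m'

lemma W2_self {X : Type*} [MetricSpace X] [CompactSpace X] [MeasurableSpace X] [BorelSpace X]
    (m : P2 X) : W2 m m = 0 := by
  have h := W2_sq_le_cost (diagonal_mem_plans m.meas)
  rw [cost_diagonal] at h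
  exact pow_eq_zero_iff two_ne_zero |>.1 (le_antisymm h (sq_nonneg _))

variable {f : Time T → Torus d → P2 (Torus d) → U → V → EuclideanSpace ℝ (Fin d)} {M L : ℝ≥0}

lemma Dynamics.continuous_uv (hf : Dynamics f M L) (t : Time T) (x : Torus d) (m : P2 (Torus d)) :
    Continuous fun w : U × V => f t x m w.1 w.2 :=
  hf.cont.comp (by fun_prop : Continuous fun w : U × V => (t, x, m, w.1, w.2))

lemma Dynamics.measurable_velocity (hf : Dynamics f M L) (m : C(Time T, P2 (Torus d)))
    (η : Relaxed T (U × V)) (x : C(Time T, Torus d)) : Measurable (velocity f m η x) := by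
  have h : Continuous fun p : Time T × (U × V) => f p.1 (x p.1) (m p.1) p.2.1 p.2.2 :=
    hf.cont.comp (by fun_prop :
      Continuous fun p : Time T × (U × V) => (p.1, x p.1, m p.1, p.2.1, p.2.2))
  exact (h.stronglyMeasurable.integral_kernel_prod_right' (κ := η.rep.ker)).measurable

lemma Dynamics.norm_velocity_le (hf : Dynamics f M L) (m : C(Time T, P2 (Torus d)))
    (η : Relaxed T (U × V)) (x : C(Time T, Torus d)) (τ : Time T) : ‖velocity f m η x τ‖ ≤ M := by
  have h := norm_integral_le_of_norm_le_const (μ := η.rep.ker τ)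
    (ae_of_all _ fun w : U × V => hf.bound τ (x τ) (m τ) w.1 w.2)
  simpa [velocity] using h

lemma Dynamics.integrable_velocity (hf : Dynamics f M L) (m : C(Time T, P2 (Torus d)))
    (η : Relaxed T (U × V)) (x : C(Time T, Torus d)) : Integrable (velocity f m η x) :=
  Integrable.of_bound (hf.measurable_velocity m η x).aestronglyMeasurable M
    (ae_of_all _ (hf.norm_velocity_le m η x))

/-- Since `traj` is a choice among the motions, existence alone yields the integral equation, which
is all that the later estimates use. -/
lemma Dynamics.isMotion_traj (hf : Dynamics f M L) (s : Time T) (y : Torus d)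
    (m : C(Time T, P2 (Torus d))) (η : Relaxed T (U × V)) :
    IsMotion f s y m η (traj f s m y η) := by
  refine Classical.epsilon_spec (p := IsMotion f s y m η) ?_
  refine exists_motion (fun τ z => ∫ w : U × V, f τ z (m τ) w.1 w.2 ∂(η.rep.ker τ)) (M := M)
    (K := L) ?_ ?_ (hf.measurable_velocity m η) s y
  · intro τ z
    exact hf.norm_velocity_le m η (.const _ z) τ
  · intro τ z z'
    rw [← integral_sub (integrable_of_continuous (hf.continuous_uv _ _ _))
      (integrable_of_continuous (hf.continuous_uv _ _ _))]
    have h := norm_integral_le_of_norm_le_const (μ := η.rep.ker τ)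
      (ae_of_all _ fun w : U × V => hf.lip τ z z' (m τ) (m τ) w.1 w.2)
    simpa [W2_self] using h

/-- The displacement of a motion between two times. -/
lemma Dynamics.traj_apply (hf : Dynamics f M L) {s t : Time T} (hst : s ≤ t) (y : Torus d)
    (m : C(Time T, P2 (Torus d))) (η : Relaxed T (U × V)) :
    traj f s m y η t = y + QuotientAddGroup.mk
      (∫ τ in Set.Ioc s t, velocity f m η (traj f s m y η) τ) := by
  have h := hf.isMotion_traj s y m η t
  rw [Set.Ioc_eq_empty (not_lt.2 hst)] at h
  simpa using h

lemma volume_real_time_Ioc {s t : Time T} (hst : s ≤ t) :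
    (volume : Measure (Time T)).real (Set.Ioc s t) = (t : ℝ) - s := by
  rw [Measure.real, volume_time_Ioc, ENNReal.toReal_ofReal (sub_nonneg.2 hst)]

lemma Dynamics.norm_displacement_le (hf : Dynamics f M L) {s t : Time T} (hst : s ≤ t)
    (m : C(Time T, P2 (Torus d))) (η : Relaxed T (U × V)) (x : C(Time T, Torus d)) :
    ‖∫ τ in Set.Ioc s t, velocity f m η x τ‖ ≤ M * ((t : ℝ) - s) := by
  rw [← volume_real_time_Ioc hst]
  exact norm_setIntegral_le_of_norm_le_const (measure_lt_top _ _)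
    fun τ _ => hf.norm_velocity_le m η x τ

lemma Dynamics.dist_traj_le (hf : Dynamics f M L) {s t : Time T} (hst : s ≤ t) (y : Torus d)
    (m : C(Time T, P2 (Torus d))) (η : Relaxed T (U × V)) :
    dist (traj f s m y η t) y ≤ M * ((t : ℝ) - s) := by
  rw [hf.traj_apply hst, dist_eq_norm, add_sub_cancel_left]
  exact (Torus.norm_mk_le _).trans (hf.norm_displacement_le hst _ _ _)

/-! ### Exchange of the players -/

/-- The two predicates must be equal as predicates: then the choice made in `traj` is the same for
both games. -/
lemma isMotion_swap (s : Time T) (y : Torus d) (m : C(Time T, P2 (Torus d)))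
    (ξ : Relaxed T U) (ζ : Relaxed T V) :
    IsMotion (fun t x m v u => f t x m u v) s y m (ζ.prod ξ) = IsMotion f s y m (ξ.prod ζ) := by
  have h : ∀ x : C(Time T, Torus d), velocity (fun t x m v u => f t x m u v) m (ζ.prod ξ) x
      =ᵐ[volume] velocity f m (ξ.prod ζ) x := by
    intro x
    filter_upwards [Relaxed.rep_prod_ae ξ ζ, Relaxed.rep_prod_ae ζ ξ] with τ h1 h2
    rw [velocity, velocity, h1, h2]
    exact integral_prod_swap (fun w : U × V => f τ (x τ) (m τ) w.1 w.2)
  funext x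
  refine propext (forall_congr' fun t => ?_)
  rw [integral_congr_ae (ae_restrict_of_ae (h x)), integral_congr_ae (ae_restrict_of_ae (h x))]

lemma traj_swap (s : Time T) (m : C(Time T, P2 (Torus d))) (y : Torus d)
    (ξ : Relaxed T U) (ζ : Relaxed T V) :
    traj (fun t x m v u => f t x m u v) s m y (ζ.prod ξ) = traj f s m y (ξ.prod ζ) := by
  rw [traj, traj, isMotion_swap]

/-- The distribution of pairs of controls with the roles of the players exchanged. -/
def PairDistr.swap (κ : PairDistr T d U V) : PairDistr T d V U :=
  ⟨κ.ker.map Prod.swap, Kernel.IsMarkovKernel.map _ measurable_swap⟩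

lemma PairDistr.swap_ker_apply (κ : PairDistr T d U V) (x : Torus d) :
    (PairDistr.swap κ).ker x = (κ.ker x).map Prod.swap :=
  Kernel.map_apply _ measurable_swap x

/-- Makes a proof that `traj` is measurable superfluous: the image under a map that is not a.e.
measurable is 0 by convention, while the image that defines a flow is a probability. -/
lemma aemeasurable_of_isProbabilityMeasure_map {A B : Type*} [MeasurableSpace A]
    [MeasurableSpace B] {μ : Measure A} {h : A → B} [IsProbabilityMeasure (μ.map h)] :
    AEMeasurable h μ := by
  by_contra hc
  have : μ.map h = 0 := Measure.map_of_not_aemeasurable hc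
  exact IsProbabilityMeasure.ne_zero (μ.map h) this

lemma IsFlow.aemeasurable {s : Time T} {mStar : P2 (Torus d)} {κ : PairDistr T d U V}
    {m : C(Time T, P2 (Torus d))} (h : IsFlow f s mStar κ m) :
    AEMeasurable (fun p : Torus d × Relaxed T U × Relaxed T V =>
      traj f s m p.1 (p.2.1.prod p.2.2)) (mStar.meas ⊗ₘ κ.ker) := by
  obtain ⟨γ, -, -, hγ⟩ := h
  have : IsProbabilityMeasure ((mStar.meas ⊗ₘ κ.ker).map
      fun p : Torus d × Relaxed T U × Relaxed T V => traj f s m p.1 (p.2.1.prod p.2.2)) := by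
    rw [← hγ]
    infer_instance
  exact aemeasurable_of_isProbabilityMeasure_map

lemma IsFlow.swap {s : Time T} {mStar : P2 (Torus d)} {κ : PairDistr T d U V}
    {m : C(Time T, P2 (Torus d))} (h : IsFlow f s mStar κ m) :
    IsFlow (fun t x m v u => f t x m u v) s mStar (PairDistr.swap κ) m := by
  have hae := h.aemeasurable
  obtain ⟨γ, h1, h2, h3⟩ := h
  refine ⟨γ, h1, h2, ?_⟩
  let e : Torus d × Relaxed T U × Relaxed T V ≃ᵐ Torus d × Relaxed T V × Relaxed T U :=
    (MeasurableEquiv.refl _).prodCongr MeasurableEquiv.prodComm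
  have h4 : mStar.meas ⊗ₘ (PairDistr.swap κ).ker = (mStar.meas ⊗ₘ κ.ker).map e :=
    Measure.compProd_map measurable_swap
  have h5 : (fun p : Torus d × Relaxed T V × Relaxed T U =>
      traj (fun t x m v u => f t x m u v) s m p.1 (p.2.1.prod p.2.2)) ∘ e
      = fun p : Torus d × Relaxed T U × Relaxed T V => traj f s m p.1 (p.2.1.prod p.2.2) := by
    funext p
    exact traj_swap s m p.1 p.2.1 p.2.2
  rw [h4, AEMeasurable.map_map_of_aemeasurable _ e.measurable.aemeasurable, h5, h3]
  rw [e.measurableEmbedding.aemeasurable_map_iff, h5]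
  exact hae

lemma PairDistr.swap_mem_D1 {β : WM (Torus d) (Relaxed T V)} {κ : PairDistr T d U V}
    (h : κ ∈ D2 β) : PairDistr.swap κ ∈ D1 β := by
  intro x
  rw [PairDistr.swap_ker_apply, Measure.map_map measurable_fst measurable_swap]
  exact h x

lemma PairDistr.swap_mem_D2 {α : WM (Torus d) (Relaxed T U)} {κ : PairDistr T d U V}
    (h : κ ∈ D1 α) : PairDistr.swap κ ∈ D2 α := by
  intro x
  rw [PairDistr.swap_ker_apply, Measure.map_map measurable_snd measurable_swap]
  exact h x

lemma Dynamics.swap (hf : Dynamics f M L) : Dynamics (fun t x m v u => f t x m u v) M L where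
  cont := hf.cont.comp (by fun_prop : Continuous fun p : Time T × Torus d × P2 (Torus d) × V × U =>
    (p.1, p.2.1, p.2.2.1, p.2.2.2.2, p.2.2.2.1))
  bound := fun t x m v u => hf.bound t x m u v
  lip := fun t x x' m m' v u => hf.lip t x x' m m' u v

end Motions

/-! ### One step of a flow under a constant distribution of controls -/

section Step

lemma continuous_iSup_of_compact {A B : Type*} [TopologicalSpace A] [TopologicalSpace B]
    [CompactSpace B] {F : A → B → ℝ} (hF : Continuous fun p : A × B => F p.1 p.2) :
    Continuous fun a => ⨆ b, F a b := by
  have h := isCompact_univ.continuous_sSup (f := F) hF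
  simp only [Set.image_univ] at h
  exact h

lemma bddAbove_range_of_compact {B : Type*} [TopologicalSpace B] [CompactSpace B] {F : B → ℝ}
    (hF : Continuous F) : BddAbove (Set.range F) := (isCompact_range hF).bddAbove

variable {T : ℝ≥0} {d : ℕ} {U V : Type*}
  [MetricSpace U] [CompactSpace U] [MeasurableSpace U] [BorelSpace U]
  [MetricSpace V] [CompactSpace V] [MeasurableSpace V] [BorelSpace V]
  {f : Time T → Torus d → P2 (Torus d) → U → V → EuclideanSpace ℝ (Fin d)} {M L : ℝ≥0}

lemma Dynamics.continuous_support (hf : Dynamics f M L) (s : Time T) (m : P2 (Torus d)) :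
    Continuous fun p : EuclideanSpace ℝ (Fin d) × Torus d × U =>
      ⨆ v, inner ℝ p.1 (f s p.2.1 m p.2.2 v) := by
  refine continuous_iSup_of_compact (F := fun (p : EuclideanSpace ℝ (Fin d) × Torus d × U) v =>
    inner ℝ p.1 (f s p.2.1 m p.2.2 v)) ?_
  refine continuous_fst.fst.inner (hf.cont.comp (by fun_prop : Continuous
    fun p : (EuclideanSpace ℝ (Fin d) × Torus d × U) × V => (s, p.1.2.1, m, p.1.2.2, p.2)))

lemma Dynamics.continuous_inner (hf : Dynamics f M L) (s : Time T) (x : Torus d)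
    (m : P2 (Torus d)) (w : EuclideanSpace ℝ (Fin d)) :
    Continuous fun p : U × V => inner ℝ w (f s x m p.1 p.2) :=
  continuous_const.inner (hf.continuous_uv s x m)

/-- The triples (initial point, control of the first player, terminal point) such that the
displacement in each direction is bounded by the support function of the velocities. -/
def reachable (f : Time T → Torus d → P2 (Torus d) → U → V → EuclideanSpace ℝ (Fin d))
    (s : Time T) (m : P2 (Torus d)) (M δ φ : ℝ) : Set ((Torus d × U) × Torus d) :=
  {z | ∃ q : EuclideanSpace ℝ (Fin d), z.2 = z.1.1 + QuotientAddGroup.mk q ∧ ‖q‖ ≤ M * δ ∧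
    ∀ w, inner ℝ w q ≤ δ * ((⨆ v, inner ℝ w (f s z.1.1 m z.1.2 v)) + φ * ‖w‖)}

/-- Closedness provides the measurability needed to carry membership through an image measure. The
displacements q are bounded, so the set is a continuous image of a compact one. -/
lemma Dynamics.isClosed_reachable (hf : Dynamics f M L) (s : Time T) (m : P2 (Torus d))
    (M' δ φ : ℝ) : IsClosed (reachable f s m M' δ φ) := by
  let C : Set ((Torus d × U) × EuclideanSpace ℝ (Fin d)) := {p | ‖p.2‖ ≤ M' * δ ∧
    ∀ w, inner ℝ w p.2 ≤ δ * ((⨆ v, inner ℝ w (f s p.1.1 m p.1.2 v)) + φ * ‖w‖)}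
  have hC : IsClosed C := by
    have h0 : IsClosed {p : (Torus d × U) × EuclideanSpace ℝ (Fin d) | ‖p.2‖ ≤ M' * δ} :=
      isClosed_le (by fun_prop) continuous_const
    have h1 : IsClosed {p : (Torus d × U) × EuclideanSpace ℝ (Fin d) |
        ∀ w, inner ℝ w p.2 ≤ δ * ((⨆ v, inner ℝ w (f s p.1.1 m p.1.2 v)) + φ * ‖w‖)} := by
      rw [Set.ofPred_forall]
      refine isClosed_iInter fun w => isClosed_le (by fun_prop) ?_
      have h := (hf.continuous_support s m).comp (by fun_prop : Continuous
        fun p : (Torus d × U) × EuclideanSpace ℝ (Fin d) => (w, p.1.1, p.1.2))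
      exact continuous_const.mul (h.add continuous_const)
    exact h0.inter h1
  have hC' : IsCompact C := (isCompact_univ.prod (isCompact_closedBall 0 (M' * δ))).of_isClosed_subset
    hC fun p hp => ⟨Set.mem_univ _, mem_closedBall_zero_iff.2 hp.1⟩
  have he : reachable f s m M' δ φ
      = (fun p : (Torus d × U) × EuclideanSpace ℝ (Fin d) =>
        (p.1, p.1.1 + (QuotientAddGroup.mk p.2 : Torus d))) '' C := by
    ext z
    constructor
    · rintro ⟨q, h1, h2, h3⟩
      exact ⟨(z.1, q), ⟨h2, h3⟩, Prod.ext rfl h1.symm⟩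
    · rintro ⟨⟨a, q⟩, ⟨h2, h3⟩, rfl⟩
      exact ⟨q, rfl, h2, h3⟩
  rw [he]
  refine (hC'.image ?_).isClosed
  exact continuous_fst.prodMk (continuous_fst.fst.add (Torus.continuous_mk.comp continuous_snd))

/-- Along the motion the velocity differs from that frozen at (s, y, m) by at most ω in time and by
LMδ each in state and distribution, where δ = r - s. Bounds tested against a fixed w survive
averaging over ζ and integration in time, so the opponent's relaxed control disappears into the
support function. -/
lemma Dynamics.traj_mem_reachable (hf : Dynamics f M L) {s r : Time T} (hsr : s ≤ r)
    (μ : C(Time T, P2 (Torus d))) (m : P2 (Torus d)) {ω : ℝ}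
    (hW : ∀ τ, s ≤ τ → τ ≤ r → W2 (μ τ) m ≤ M * ((r : ℝ) - s))
    (hω : ∀ τ, s ≤ τ → τ ≤ r → ∀ x m u v, ‖f τ x m u v - f s x m u v‖ ≤ ω)
    (y : Torus d) (u : U) (ζ : Relaxed T V) :
    ((y, u), traj f s μ y ((Relaxed.const u).prod ζ) r)
      ∈ reachable f s m M ((r : ℝ) - s) (ω + 2 * L * M * ((r : ℝ) - s)) := by
  set η := (Relaxed.const u : Relaxed T U).prod ζ
  set x := traj f s μ y η with hx
  refine ⟨_, hf.traj_apply hsr y μ η, hf.norm_displacement_le hsr _ _ _, fun w => ?_⟩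
  set A := (⨆ v, inner ℝ w (f s y m u v)) + (ω + 2 * L * M * ((r : ℝ) - s)) * ‖w‖
  have hpt : ∀ τ, s ≤ τ → τ ≤ r → ∀ v, inner ℝ w (f τ (x τ) (μ τ) u v) ≤ A := by
    intro τ h1 h2 v
    have e1 : ‖f τ (x τ) (μ τ) u v - f s y m u v‖ ≤ ω + 2 * L * M * ((r : ℝ) - s) := by
      have e2 := hω τ h1 h2 (x τ) (μ τ) u v
      have e3 := hf.lip s (x τ) y (μ τ) m u v
      have e4 : dist (x τ) y ≤ M * ((r : ℝ) - s) := by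
        refine (hf.dist_traj_le h1 y μ η).trans (mul_le_mul_of_nonneg_left ?_ M.2)
        have : (τ : ℝ) ≤ r := h2
        linarith
      have e5 := mul_le_mul_of_nonneg_left e4 L.2
      have e6 := mul_le_mul_of_nonneg_left (hW τ h1 h2) L.2
      have e7 := norm_add_le (f τ (x τ) (μ τ) u v - f s (x τ) (μ τ) u v)
        (f s (x τ) (μ τ) u v - f s y m u v)
      rw [sub_add_sub_cancel] at e7
      simp only [NNReal.val_eq_coe] at e5 e6
      linarith
    have e8 : inner ℝ w (f s y m u v) ≤ ⨆ v, inner ℝ w (f s y m u v) :=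
      le_ciSup (f := fun v => inner ℝ w (f s y m u v)) (bddAbove_range_of_compact
        ((hf.continuous_inner s y m w).comp (by fun_prop : Continuous fun v : V => (u, v)))) v
    have e9 := real_inner_le_norm w (f τ (x τ) (μ τ) u v - f s y m u v)
    rw [inner_sub_right] at e9
    have e10 := mul_le_mul_of_nonneg_left e1 (norm_nonneg w)
    simp only [A]
    linarith
  have hvel : ∀ᵐ τ : Time T, s ≤ τ → τ ≤ r → inner ℝ w (velocity f μ η x τ) ≤ A := by
    filter_upwards [Relaxed.rep_prod_ae (Relaxed.const u : Relaxed T U) ζ,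
      Relaxed.rep_const_ae (T := T) u] with τ h1 h2 h3 h4
    rw [velocity, h1, h2, Measure.dirac_prod, integral_map (by fun_prop)
      (hf.continuous_uv _ _ _).aestronglyMeasurable]
    have hc : Continuous fun v : V => f τ (x τ) (μ τ) u v :=
      (hf.continuous_uv τ (x τ) (μ τ)).comp (by fun_prop : Continuous fun v : V => (u, v))
    rw [← integral_inner (integrable_of_continuous hc)]
    calc ∫ v, inner ℝ w (f τ (x τ) (μ τ) u v) ∂(ζ.rep.ker τ) ≤ ∫ _v, A ∂(ζ.rep.ker τ) :=
          integral_mono (integrable_of_continuous (continuous_const.inner hc))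
            (integrable_const _) (hpt τ h3 h4)
      _ = A := by simp
  rw [← integral_inner (hf.integrable_velocity μ η x).integrableOn]
  calc ∫ τ in Set.Ioc s r, inner ℝ w (velocity f μ η x τ) ≤ ∫ _τ in Set.Ioc s r, A := by
        refine integral_mono_ae ((hf.integrable_velocity μ η x).integrableOn.const_inner w)
          (integrable_const _) ?_
        filter_upwards [ae_restrict_of_ae hvel, ae_restrict_mem measurableSet_Ioc] with τ h1 h2
        exact h1 h2.1.le h2.2
    _ = ((r : ℝ) - s) * A := by
        rw [setIntegral_const, volume_real_time_Ioc hsr, smul_eq_mul]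

/-- The coupling is the joint law of the current and initial points of the motions, whose speed is
at most M. -/
lemma Dynamics.W2_flow_le (hf : Dynamics f M L) {s : Time T} {m : P2 (Torus d)}
    {κ : PairDistr T d U V} {μ : C(Time T, P2 (Torus d))} (h : IsFlow f s m κ μ) {t : Time T}
    (hst : s ≤ t) : W2 (μ t) m ≤ M * ((t : ℝ) - s) := by
  have hae := h.aemeasurable
  obtain ⟨γ, h1, -, h3⟩ := h
  have ht : Measurable fun x : C(Time T, Torus d) => x t :=
    (continuous_eval_const t).measurable
  set tr := fun p : Torus d × Relaxed T U × Relaxed T V => traj f s μ p.1 (p.2.1.prod p.2.2)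
  have hp : AEMeasurable (fun p => (tr p t, p.1)) (m.meas ⊗ₘ κ.ker) :=
    (ht.comp_aemeasurable hae).prodMk measurable_fst.aemeasurable
  have hπ : (m.meas ⊗ₘ κ.ker).map (fun p => (tr p t, p.1)) ∈ plans (μ t).meas m.meas := by
    constructor
    · rw [AEMeasurable.map_map_of_aemeasurable measurable_fst.aemeasurable hp, h1, h3,
        AEMeasurable.map_map_of_aemeasurable ht.aemeasurable hae]
      rfl
    · rw [AEMeasurable.map_map_of_aemeasurable measurable_snd.aemeasurable hp]
      exact Measure.fst_compProd _ _
  have hnn : 0 ≤ M * ((t : ℝ) - s) := mul_nonneg M.2 (sub_nonneg.2 hst)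
  refine le_of_sq_le_sq ((W2_sq_le_cost hπ).trans ?_) hnn
  have hcont : Continuous fun p : Torus d × Torus d => dist p.1 p.2 ^ 2 := by fun_prop
  rw [cost, integral_map hp hcont.aestronglyMeasurable]
  have hb : ∀ p, dist (tr p t) p.1 ^ 2 ≤ (M * ((t : ℝ) - s)) ^ 2 := fun p =>
    pow_le_pow_left₀ dist_nonneg (hf.dist_traj_le hst _ _ _) 2
  refine (integral_mono_of_nonneg (ae_of_all _ fun _ => sq_nonneg _)
    (integrable_const ((M * ((t : ℝ) - s)) ^ 2)) (ae_of_all _ hb)).trans ?_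
  simp

/-- The joint law of the initial point, the control of the first player and the terminal point of
a flow during whose motion the first player uses the distribution `α` of constant controls. -/
lemma Dynamics.exists_step_law (hf : Dynamics f M L) {s r : Time T} (hsr : s < r) {ω : ℝ}
    (hω : ∀ τ, s ≤ τ → τ ≤ r → ∀ x m u v, ‖f τ x m u v - f s x m u v‖ ≤ ω)
    {m : P2 (Torus d)} {α : WM (Torus d) U} {κ : PairDistr T d U V}
    (hκ : κ ∈ D1 (constToRelaxed α)) {μ : C(Time T, P2 (Torus d))} (h : IsFlow f s m κ μ) :
    ∃ ρ : Measure ((Torus d × U) × Torus d), ρ.map Prod.fst = m.meas ⊗ₘ α.ker ∧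
      ρ.map Prod.snd = (μ r).meas ∧
      ∀ᵐ z ∂ρ, z ∈ reachable f s m M ((r : ℝ) - s) (ω + 2 * L * M * ((r : ℝ) - s)) := by
  have hW : ∀ τ, s ≤ τ → τ ≤ r → W2 (μ τ) m ≤ M * ((r : ℝ) - s) := by
    intro τ h1 h2
    refine (hf.W2_flow_le h h1).trans (mul_le_mul_of_nonneg_left ?_ M.2)
    have : (τ : ℝ) ≤ r := h2
    linarith
  have hae := h.aemeasurable
  obtain ⟨γ, h1, -, h3⟩ := h
  have hr : Measurable fun x : C(Time T, Torus d) => x r :=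
    (continuous_eval_const r).measurable
  set tr := fun p : Torus d × Relaxed T U × Relaxed T V => traj f s μ p.1 (p.2.1.prod p.2.2)
  have hemb := Relaxed.measurableEmbedding_const (U := U) hsr
  have hneU : Nonempty U := by
    have := (m.meas ⊗ₘ α.ker).nonempty_of_neZero
    exact this.map Prod.snd
  obtain ⟨inv, hinv, hcomp⟩ := hemb.exists_measurable_extend measurable_id fun _ => hneU
  have hmap : κ.ker.map (inv ∘ Prod.fst) = α.ker := by
    ext1 x
    have hx : (κ.ker x).map Prod.fst = (α.ker x).map Relaxed.const :=
      (hκ x).trans (Kernel.map_apply _ Relaxed.measurable_const_control x)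
    rw [Kernel.map_apply _ (hinv.comp measurable_fst)]
    rw [← Measure.map_map hinv measurable_fst, hx,
      Measure.map_map hinv Relaxed.measurable_const_control, hcomp, Measure.map_id]
  have hconst : ∀ᵐ p ∂(m.meas ⊗ₘ κ.ker), Relaxed.const (inv p.2.1) = p.2.1 := by
    have hmem : ∀ᵐ p ∂(m.meas ⊗ₘ κ.ker), p.2.1 ∈ Set.range (Relaxed.const : U → Relaxed T U) := by
      refine Measure.ae_compProd_of_ae_ae
        ((measurable_fst.comp measurable_snd) hemb.measurableSet_range) (ae_of_all _ fun x => ?_)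
      have hx : (κ.ker x).map Prod.fst = (α.ker x).map Relaxed.const :=
        (hκ x).trans (Kernel.map_apply _ Relaxed.measurable_const_control x)
      have h4 : ∀ᵐ ξ ∂((κ.ker x).map Prod.fst), ξ ∈ Set.range (Relaxed.const : U → Relaxed T U) := by
        rw [hx]
        exact (ae_map_iff Relaxed.measurable_const_control.aemeasurable
          (p := fun ξ => ξ ∈ Set.range (Relaxed.const : U → Relaxed T U))
          hemb.measurableSet_range).2 (ae_of_all _ fun u => ⟨u, rfl⟩)
      exact ae_of_ae_map measurable_fst.aemeasurable h4
    filter_upwards [hmem] with p hp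
    obtain ⟨u, hu⟩ := hp
    rw [← hu]
    exact congrArg Relaxed.const (congrFun hcomp u)
  have hfst : Measurable fun p : Torus d × Relaxed T U × Relaxed T V => (p.1, inv p.2.1) :=
    measurable_fst.prodMk (hinv.comp (measurable_fst.comp measurable_snd))
  have hG : AEMeasurable (fun p => ((p.1, inv p.2.1), tr p r)) (m.meas ⊗ₘ κ.ker) :=
    hfst.aemeasurable.prodMk (hr.comp_aemeasurable hae)
  refine ⟨(m.meas ⊗ₘ κ.ker).map fun p => ((p.1, inv p.2.1), tr p r), ?_, ?_, ?_⟩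
  · rw [AEMeasurable.map_map_of_aemeasurable measurable_fst.aemeasurable hG, ← hmap,
      Measure.compProd_map (hinv.comp measurable_fst)]
    rfl
  · rw [AEMeasurable.map_map_of_aemeasurable measurable_snd.aemeasurable hG, h1, h3,
      AEMeasurable.map_map_of_aemeasurable hr.aemeasurable hae]
    rfl
  · refine (ae_map_iff hG (p := fun z => z ∈ reachable f s m M ((r : ℝ) - s)
      (ω + 2 * L * M * ((r : ℝ) - s))) (hf.isClosed_reachable _ _ _ _ _).measurableSet).2 ?_
    filter_upwards [hconst] with p hp
    have h5 := hf.traj_mem_reachable hsr.le μ m hW hω p.1 (inv p.2.1) p.2.2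
    rw [hp] at h5
    exact h5

end Step

/-! ### Extremal shift -/

section Selection

/-- A Carathéodory function on a compact space has a measurable selection of almost minimizers. -/
lemma exists_measurable_near_min {A Y : Type*} [MeasurableSpace A] [TopologicalSpace Y]
    [CompactSpace Y] [TopologicalSpace.SeparableSpace Y] [Nonempty Y] [MeasurableSpace Y]
    (H : A → Y → ℝ) (hm : ∀ y, Measurable fun a => H a y) (hc : ∀ a, Continuous (H a)) {ε : ℝ}
    (hε : 0 < ε) : ∃ h : A → Y, Measurable h ∧ ∀ a y, H a (h a) ≤ H a y + ε := by
  classical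
  let u := TopologicalSpace.denseSeq Y
  have hu : DenseRange u := TopologicalSpace.denseRange_denseSeq Y
  have hex : ∀ a, ∃ n, ∀ k, H a (u n) ≤ H a (u k) + ε := by
    intro a
    obtain ⟨y₀, -, hy₀⟩ := isCompact_univ.exists_isMinOn Set.univ_nonempty (hc a).continuousOn
    obtain ⟨n, hn⟩ := hu.exists_mem_open (isOpen_lt (hc a) continuous_const)
      (s := {y | H a y < H a y₀ + ε}) ⟨y₀, by simp [hε]⟩
    refine ⟨n, fun k => ?_⟩
    have h1 : H a (u n) < H a y₀ + ε := hn
    have h2 : H a y₀ ≤ H a (u k) := hy₀ (Set.mem_univ _)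
    linarith
  -- The first member of the dense sequence that is ε-optimal within the sequence: countably many
  -- measurable conditions. Density and continuity extend the optimality to every y.
  refine ⟨fun a => u (Nat.find (hex a)),
    Measurable.find (f := fun n _ => u n) (fun _ => measurable_const) (fun n => ?_) hex, ?_⟩
  · rw [Set.ofPred_forall]
    exact MeasurableSet.iInter fun k => measurableSet_le (hm _) ((hm _).add_const _)
  · intro a y
    have hcl : IsClosed {y | H a (u (Nat.find (hex a))) ≤ H a y + ε} :=
      isClosed_le continuous_const ((hc a).add continuous_const)
    have := hcl.closure_subset_iff.2 (Set.range_subset_iff.2 (Nat.find_spec (hex a))) (hu y)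
    exact this

/-- Almost optimal controls of the two players in a matrix game with a saddle value. -/
lemma iSup_add_iSup_neg_le {U V : Type*} [TopologicalSpace U] [CompactSpace U]
    [TopologicalSpace V] [CompactSpace V] [Nonempty U] [Nonempty V] {F : U → V → ℝ}
    (hF : Continuous fun p : U × V => F p.1 p.2)
    (hI : (⨅ u, ⨆ v, F u v) = ⨆ v, ⨅ u, F u v) {ε : ℝ} {u₀ : U} {v₀ : V}
    (hu : ∀ u, (⨆ v, F u₀ v) ≤ (⨆ v, F u v) + ε)
    (hv : ∀ v, (⨆ u, -F u v₀) ≤ (⨆ u, -F u v) + ε) :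
    (⨆ v, F u₀ v) + (⨆ u, -F u v₀) ≤ 2 * ε := by
  -- Each guarantee is within ε of its own value, upper or lower; `hI` identifies the two values,
  -- which then cancel.
  have h1 : (⨆ v, F u₀ v) - ε ≤ ⨅ u, ⨆ v, F u v := le_ciInf fun u => by linarith [hu u]
  have h2 : (⨆ v, ⨅ u, F u v) ≤ ε - ⨆ u, -F u v₀ := by
    refine ciSup_le fun v => ?_
    have hc : Continuous fun u => F u v := hF.comp (by fun_prop : Continuous fun u : U => (u, v))
    have h3 : (⨆ u, -F u v) ≤ -⨅ u, F u v :=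
      ciSup_le fun u => neg_le_neg (ciInf_le (f := fun u => F u v)
        (isCompact_range hc).bddBelow u)
    linarith [hv v]
  linarith

end Selection

/-! ### Gluing transition laws along a plan -/

section Gluing

variable {A U V : Type*} [MetricSpace A] [CompactSpace A] [MeasurableSpace A] [BorelSpace A]
  [MeasurableSpace U] [MeasurableSpace V]

lemma compProd_condKernel_of_eq_fst {B C : Type*} [MeasurableSpace B] [MeasurableSpace C]
    [StandardBorelSpace C] [Nonempty C] {ρ : Measure (B × C)} [IsFiniteMeasure ρ] {μ : Measure B}
    (h : μ = ρ.fst) : μ ⊗ₘ ρ.condKernel = ρ := by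
  rw [h]
  exact ρ.disintegrate ρ.condKernel

/-- Drawing p from π and then the end point from ρ conditioned on h p reproduces ρ, because h p has
the law of the first marginal of ρ. -/
lemma comap_condKernel_comp {B C : Type*} [MeasurableSpace B] [MeasurableSpace C] [Nonempty A]
    (ρ : Measure (B × A)) [IsFiniteMeasure ρ] {π : Measure C} {h : C → B} (hh : Measurable h)
    (hρ : ρ.map Prod.fst = π.map h) :
    (ρ.condKernel.comap h hh) ∘ₘ π = ρ.map Prod.snd := by
  rw [← Kernel.comp_deterministic_eq_comap, ← Measure.comp_assoc,
    Measure.deterministic_comp_eq_map, ← hρ]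
  change ρ.condKernel ∘ₘ ρ.fst = _
  rw [← Measure.snd_compProd, Measure.disintegrate]
  rfl

/-- A plan between initial points and two transitions from the initial points, which depend on
controls chosen from the plan, are glued together to a plan between the terminal points. -/
lemma exists_plan_of_transitions {π : Measure (A × A)} [IsProbabilityMeasure π]
    {u : A × A → U} {v : A × A → V} (hu : Measurable u) (hv : Measurable v)
    {ρ : Measure ((A × U) × A)} {ρ' : Measure ((A × V) × A)}
    (hρ : ρ.map Prod.fst = π.map fun p => (p.1, u p))
    (hρ' : ρ'.map Prod.fst = π.map fun p => (p.2, v p))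
    {G : Set ((A × U) × A)} {G' : Set ((A × V) × A)}
    (hG : ∀ᵐ z ∂ρ, z ∈ G) (hG' : ∀ᵐ z ∂ρ', z ∈ G') {B : A × A → ℝ} (hB : Integrable B π)
    (hle : ∀ p X Y, ((p.1, u p), X) ∈ G → ((p.2, v p), Y) ∈ G' → dist X Y ^ 2 ≤ B p) :
    ∃ π' ∈ plans (ρ.map Prod.snd) (ρ'.map Prod.snd), cost π' ≤ ∫ p, B p ∂π := by
  have hh : Measurable fun p : A × A => (p.1, u p) := measurable_fst.prodMk hu
  have hh' : Measurable fun p : A × A => (p.2, v p) := measurable_snd.prodMk hv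
  have : Nonempty A := π.nonempty_of_neZero.map Prod.fst
  have hpρ : IsProbabilityMeasure ρ := by
    have : IsProbabilityMeasure (ρ.map Prod.fst) := by
      rw [hρ]; exact Measure.isProbabilityMeasure_map hh.aemeasurable
    exact isProbabilityMeasure_of_map measurable_fst
  have hpρ' : IsProbabilityMeasure ρ' := by
    have : IsProbabilityMeasure (ρ'.map Prod.fst) := by
      rw [hρ']; exact Measure.isProbabilityMeasure_map hh'.aemeasurable
    exact isProbabilityMeasure_of_map measurable_fst
  set K := ρ.condKernel.comap _ hh with hK
  set K' := ρ'.condKernel.comap _ hh' with hK'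
  have hae : ∀ᵐ p ∂π, ∀ᵐ X ∂(K p), ((p.1, u p), X) ∈ G := by
    have h1 : ∀ᵐ z ∂(ρ.fst ⊗ₘ ρ.condKernel), z ∈ G := by rwa [Measure.disintegrate]
    have h2 := Measure.ae_ae_of_ae_compProd h1
    rw [Measure.fst, hρ] at h2
    exact ae_of_ae_map hh.aemeasurable h2
  have hae' : ∀ᵐ p ∂π, ∀ᵐ Y ∂(K' p), ((p.2, v p), Y) ∈ G' := by
    have h1 : ∀ᵐ z ∂(ρ'.fst ⊗ₘ ρ'.condKernel), z ∈ G' := by rwa [Measure.disintegrate]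
    have h2 := Measure.ae_ae_of_ae_compProd h1
    rw [Measure.fst, hρ'] at h2
    exact ae_of_ae_map hh'.aemeasurable h2
  have hd : Continuous fun p : A × A => dist p.1 p.2 ^ 2 := by fun_prop
  -- The terminal points are drawn independently given p. No finer coupling is needed, as `hle`
  -- bounds the distance for every admissible pair.
  refine ⟨(π ⊗ₘ (K ×ₖ K')).snd, ⟨?_, ?_⟩, ?_⟩
  · rw [Measure.snd_compProd, Measure.map_comp _ _ measurable_fst]
    rw [← Kernel.fst_eq, Kernel.fst_prod, hK, comap_condKernel_comp ρ hh hρ]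
  · rw [Measure.snd_compProd, Measure.map_comp _ _ measurable_snd]
    rw [← Kernel.snd_eq, Kernel.snd_prod, hK', comap_condKernel_comp ρ' hh' hρ']
  · have hint : Integrable (fun z : (A × A) × (A × A) => dist z.2.1 z.2.2 ^ 2)
        (π ⊗ₘ (K ×ₖ K')) := integrable_of_continuous (by fun_prop)
    rw [cost, Measure.snd, integral_map measurable_snd.aemeasurable hd.aestronglyMeasurable,
      Measure.integral_compProd hint]
    refine integral_mono_of_nonneg (ae_of_all _ fun p => integral_nonneg fun _ => sq_nonneg _) hB ?_
    filter_upwards [hae, hae'] with p h1 h2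
    rw [Kernel.prod_apply]
    have h3 : ∀ᵐ z ∂((K p).prod (K' p)), dist z.1 z.2 ^ 2 ≤ B p := by
      filter_upwards [Measure.quasiMeasurePreserving_fst.ae h1,
        Measure.quasiMeasurePreserving_snd.ae h2] with z h4 h5
      exact hle p z.1 z.2 h4 h5
    calc ∫ z, dist z.1 z.2 ^ 2 ∂((K p).prod (K' p)) ≤ ∫ _z, B p ∂((K p).prod (K' p)) :=
          integral_mono_ae (integrable_of_continuous hd) (integrable_const _) h3
      _ = B p := by simp

end Gluing

/-! ### The extremal shift estimate over one step -/

section OneStep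

variable {T : ℝ≥0} {d : ℕ} {U V : Type*}
  [MetricSpace U] [CompactSpace U] [MeasurableSpace U] [BorelSpace U]
  [MetricSpace V] [CompactSpace V] [MeasurableSpace V] [BorelSpace V]
  {f : Time T → Torus d → P2 (Torus d) → U → V → EuclideanSpace ℝ (Fin d)} {M L : ℝ≥0}

/-- Lets both nearly optimal controls be taken in the one game at (x, m), although the guide moves
from (y, ν). -/
lemma Dynamics.iSup_inner_le (hf : Dynamics f M L) (s : Time T) (x y : Torus d)
    (m ν : P2 (Torus d)) (w : EuclideanSpace ℝ (Fin d)) (u : U) [Nonempty V] :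
    (⨆ v, inner ℝ w (f s y ν u v)) ≤ (⨆ v, inner ℝ w (f s x m u v))
      + ‖w‖ * (L * dist y x + L * W2 ν m) := by
  refine ciSup_le fun v => ?_
  have h1 : inner ℝ w (f s x m u v) ≤ ⨆ v, inner ℝ w (f s x m u v) :=
    le_ciSup (f := fun v => inner ℝ w (f s x m u v)) (bddAbove_range_of_compact
      ((hf.continuous_inner s x m w).comp (by fun_prop : Continuous fun v : V => (u, v)))) v
  have h2 := real_inner_le_norm w (f s y ν u v - f s x m u v)
  rw [inner_sub_right] at h2
  have h3 := mul_le_mul_of_nonneg_left (hf.lip s y x ν m u v) (norm_nonneg w)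
  linarith

/-- Two motions whose initial controls are almost optimal in the game for the direction from one
initial point to the other do not diverge. -/
lemma Dynamics.dist_sq_le_of_reachable [Nonempty U] (hf : Dynamics f M L) {s : Time T}
    {m ν : P2 (Torus d)} {δ φ ε : ℝ} (hδ : 0 ≤ δ) (hφ : 0 ≤ φ) {x y X Y : Torus d} {u₀ : U} {v₀ : V}
    (hX : ((x, u₀), X) ∈ reachable f s m M δ φ)
    (hY : ((y, v₀), Y) ∈ reachable (fun t x m v u => f t x m u v) s ν M δ φ)
    (hopt : (⨆ v, inner ℝ (Torus.lift (x - y)) (f s x m u₀ v))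
      + (⨆ u, inner ℝ (-Torus.lift (x - y)) (f s x m u v₀)) ≤ 2 * ε) :
    dist X Y ^ 2 ≤ (1 + 3 * L * δ) * dist x y ^ 2 + (L * δ * W2 ν m ^ 2
      + δ * (4 * ε + 4 * φ * √d + 4 * M ^ 2 * δ)) := by
  obtain ⟨q, hXq, hq, hqw⟩ := hX
  obtain ⟨q', hYq, hq', hqw'⟩ := hY
  obtain rfl : X = x + QuotientAddGroup.mk q := hXq
  obtain rfl : Y = y + QuotientAddGroup.mk q' := hYq
  simp only at hqw hqw' ⊢
  set w := Torus.lift (x - y) with hw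
  have hwn : ‖w‖ = dist x y := by rw [hw, Torus.norm_lift, dist_eq_norm]
  have hwd : ‖w‖ ≤ √d := by rw [hw, Torus.norm_lift]; exact Torus.norm_le _
  -- The vector w + q - q' represents X - Y but need not be the shortest representative; an upper
  -- bound is enough at the end of the step.
  have h1 : dist (x + (QuotientAddGroup.mk q : Torus d)) (y + QuotientAddGroup.mk q')
      ≤ ‖w + (q - q')‖ := by
    refine le_trans (le_of_eq ?_) (Torus.norm_mk_le _)
    rw [QuotientAddGroup.mk_add, QuotientAddGroup.mk_sub, hw, Torus.mk_lift, dist_eq_norm]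
    congr 1
    abel
  have h2 : ‖w + (q - q')‖ ^ 2 = ‖w‖ ^ 2 + 2 * (inner ℝ w q + inner ℝ (-w) q') + ‖q - q'‖ ^ 2 := by
    rw [norm_add_sq_real, inner_sub_right, inner_neg_left]
    ring
  have h3 : ‖q - q'‖ ^ 2 ≤ (2 * M * δ) ^ 2 :=
    pow_le_pow_left₀ (norm_nonneg _) ((norm_sub_le q q').trans (by linarith)) 2
  have h4 := hqw w
  have h5 := hqw' (-w)
  have h6 := hf.swap.iSup_inner_le s x y m ν (-w) v₀
  rw [norm_neg] at h5 h6
  rw [dist_comm y x, ← hwn] at h6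
  have h7 : inner ℝ w q + inner ℝ (-w) q'
      ≤ δ * (2 * ε + 2 * φ * √d + (L * ‖w‖ ^ 2 + L * (‖w‖ * W2 ν m))) := by
    have h8 : inner ℝ w q + inner ℝ (-w) q' ≤ δ * ((⨆ v, inner ℝ w (f s x m u₀ v)) + φ * ‖w‖ +
        ((⨆ u, inner ℝ (-w) (f s x m u v₀)) + ‖w‖ * (L * ‖w‖ + L * W2 ν m) + φ * ‖w‖)) := by
      have := mul_le_mul_of_nonneg_left h6 hδ
      linarith
    refine h8.trans (mul_le_mul_of_nonneg_left ?_ hδ)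
    have := mul_le_mul_of_nonneg_left hwd hφ
    nlinarith
  -- Young's inequality splits the mixed term. Its share of ‖w‖² raises the factor 2L to 3L.
  have h9 : ‖w‖ * W2 ν m ≤ (‖w‖ ^ 2 + W2 ν m ^ 2) / 2 := by
    nlinarith [sq_nonneg (‖w‖ - W2 ν m)]
  have h10 : δ * L * (‖w‖ * W2 ν m) ≤ δ * L * ((‖w‖ ^ 2 + W2 ν m ^ 2) / 2) :=
    mul_le_mul_of_nonneg_left h9 (mul_nonneg hδ L.2)
  have h11 : dist (x + (QuotientAddGroup.mk q : Torus d)) (y + QuotientAddGroup.mk q') ^ 2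
      ≤ ‖w + (q - q')‖ ^ 2 := pow_le_pow_left₀ dist_nonneg h1 2
  rw [← hwn]
  calc dist (x + (QuotientAddGroup.mk q : Torus d)) (y + QuotientAddGroup.mk q') ^ 2
      ≤ ‖w‖ ^ 2 + 2 * (δ * (2 * ε + 2 * φ * √d + (L * ‖w‖ ^ 2 + L * (‖w‖ * W2 ν m))))
        + (2 * M * δ) ^ 2 := by linarith
    _ ≤ _ := by nlinarith

/-- A measurable choice of controls minimizing, up to `ε`, the support function of the velocities
in a direction depending on the point. -/
lemma Dynamics.exists_measurable_near_optimal [Nonempty U] (hf : Dynamics f M L) (s : Time T)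
    (m : P2 (Torus d)) {w : Torus d × Torus d → EuclideanSpace ℝ (Fin d)} (hw : Measurable w)
    {ε : ℝ} (hε : 0 < ε) : ∃ u : Torus d × Torus d → U, Measurable u ∧
      ∀ p u', (⨆ v, inner ℝ (w p) (f s p.1 m (u p) v))
        ≤ (⨆ v, inner ℝ (w p) (f s p.1 m u' v)) + ε := by
  obtain ⟨S, hS⟩ : ∃ S : EuclideanSpace ℝ (Fin d) × Torus d × U → ℝ,
    S = fun p => ⨆ v, inner ℝ p.1 (f s p.2.1 m p.2.2 v) := ⟨_, rfl⟩
  have hSc : Continuous S := hS ▸ hf.continuous_support s m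
  obtain ⟨u, hu, hu'⟩ := exists_measurable_near_min (fun (p : Torus d × Torus d) u => S (w p, p.1, u))
    (fun u => hSc.measurable.comp (by fun_prop)) (fun p => hSc.comp (by fun_prop)) hε
  rw [hS] at hu'
  exact ⟨u, hu, hu'⟩

/-- The extremal shift: distributions of controls, chosen from a plan between two distributions of
positions, which keep the flows starting from these distributions close to each other. -/
lemma Dynamics.exists_extremal_shift [Nonempty U] [Nonempty V] (hf : Dynamics f M L) (s : Time T)
    (hI : ∀ x m (w : EuclideanSpace ℝ (Fin d)),
      (⨅ u, ⨆ v, inner ℝ w (f s x m u v)) = ⨆ v, ⨅ u, inner ℝ w (f s x m u v))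
    {m ν : P2 (Torus d)} {π : Measure (Torus d × Torus d)} (hπ : π ∈ plans m.meas ν.meas)
    {ε : ℝ} (hε : 0 < ε) :
    ∃ (α : WM (Torus d) U) (β : WM (Torus d) V), ∀ (r : Time T), s < r → ∀ ω : ℝ, 0 ≤ ω →
      (∀ τ, s ≤ τ → τ ≤ r → ∀ x m u v, ‖f τ x m u v - f s x m u v‖ ≤ ω) →
      ∀ κ ∈ D1 (V := V) (constToRelaxed (T := T) α), ∀ μ, IsFlow f s m κ μ →
      ∀ κ' ∈ D2 (U := U) (constToRelaxed (T := T) β), ∀ μ', IsFlow f s ν κ' μ' →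
      ∃ π' ∈ plans (μ r).meas (μ' r).meas,
        cost π' ≤ (1 + 4 * L * ((r : ℝ) - s)) * cost π + ((r : ℝ) - s) *
          (4 * ε + 4 * (ω + 2 * L * M * ((r : ℝ) - s)) * √d + 4 * M ^ 2 * ((r : ℝ) - s)) := by
  have hprob := isProbabilityMeasure_of_mem_plans hπ
  have hlift : Measurable fun p : Torus d × Torus d => Torus.lift (p.1 - p.2) :=
    Torus.measurable_lift.comp (by fun_prop)
  obtain ⟨u, hu, hu'⟩ := hf.exists_measurable_near_optimal s m hlift hε
  -- The control v is optimized at the first point and at m, not at the guide's position, so that u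
  -- and v belong to the same game.
  obtain ⟨v, hv, hv'⟩ := hf.swap.exists_measurable_near_optimal s m hlift.neg hε
  have hh : Measurable fun p : Torus d × Torus d => (p.1, u p) := measurable_fst.prodMk hu
  have hh' : Measurable fun p : Torus d × Torus d => (p.2, v p) := measurable_snd.prodMk hv
  have hp : IsProbabilityMeasure (π.map fun p => (p.1, u p)) :=
    Measure.isProbabilityMeasure_map hh.aemeasurable
  have hp' : IsProbabilityMeasure (π.map fun p => (p.2, v p)) :=
    Measure.isProbabilityMeasure_map hh'.aemeasurable
  -- α is the conditional law of u given x, and β that of v given y. The plan may send one x to many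
  -- y, each with its own direction, and this is why the controls are randomized.
  refine ⟨⟨(π.map fun p => (p.1, u p)).condKernel, inferInstance⟩,
    ⟨(π.map fun p => (p.2, v p)).condKernel, inferInstance⟩, ?_⟩
  intro r hsr ω hω0 hω κ hκ μ hμ κ' hκ' μ' hμ'
  obtain ⟨ρ, h1, h2, h3⟩ := hf.exists_step_law hsr hω hκ hμ
  obtain ⟨ρ', h1', h2', h3'⟩ := hf.swap.exists_step_law hsr
    (fun τ h h' x m v u => hω τ h h' x m u v) (PairDistr.swap_mem_D1 hκ') hμ'.swap
  have e1 : ρ.map Prod.fst = π.map fun p => (p.1, u p) := by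
    have : m.meas = (π.map fun p => (p.1, u p)).fst := by
      rw [Measure.fst_map_prodMk hu, ← hπ.1]
    exact h1.trans (compProd_condKernel_of_eq_fst this)
  have e2 : ρ'.map Prod.fst = π.map fun p => (p.2, v p) := by
    have : ν.meas = (π.map fun p => (p.2, v p)).fst := by
      rw [Measure.fst_map_prodMk hv, ← hπ.2]
    exact h1'.trans (compProd_condKernel_of_eq_fst this)
  have hδ : 0 ≤ (r : ℝ) - s := sub_nonneg.2 hsr.le
  have hφ : 0 ≤ ω + 2 * L * M * ((r : ℝ) - s) := by positivity
  have hd : Continuous fun p : Torus d × Torus d => dist p.1 p.2 ^ 2 := by fun_prop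
  rw [← h2, ← h2']
  obtain ⟨π', hπ', hc⟩ := exists_plan_of_transitions hu hv e1 e2 h3 h3'
    (B := fun p => (1 + 3 * L * ((r : ℝ) - s)) * dist p.1 p.2 ^ 2
      + (L * ((r : ℝ) - s) * W2 ν m ^ 2 + ((r : ℝ) - s) *
          (4 * ε + 4 * (ω + 2 * L * M * ((r : ℝ) - s)) * √d + 4 * M ^ 2 * ((r : ℝ) - s))))
    (integrable_of_continuous (by fun_prop)) (fun p X Y hX hY => by
      refine hf.dist_sq_le_of_reachable hδ hφ hX hY ?_
      simp only [Pi.neg_apply, inner_neg_left] at hv' ⊢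
      exact iSup_add_iSup_neg_le (F := fun u v => inner ℝ (Torus.lift (p.1 - p.2)) (f s p.1 m u v))
        (hf.continuous_inner _ _ _ _) (hI _ _ _) (hu' p) (hv' p))
  refine ⟨π', hπ', hc.trans ?_⟩
  rw [integral_add ((integrable_of_continuous hd).const_mul _) (integrable_const _),
    integral_const_mul]
  -- The contribution of the distribution variable is absorbed into the cost of π, turning 3L into
  -- 4L.
  have h4 := mul_le_mul_of_nonneg_left (W2_sq_le_cost' hπ) (mul_nonneg L.2 hδ)
  simp only [integral_const, probReal_univ, one_smul]
  change (1 + 3 * L * ((r : ℝ) - s)) * cost π + _ ≤ _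
  simp only [NNReal.val_eq_coe] at h4
  linarith

end OneStep

/-! ### Guaranteed outcomes -/

section Values

lemma exists_partition_mesh_lt {T : ℝ≥0} (t₀ : Time T) {δ : ℝ} (hδ : 0 < δ) :
    ∃ Δ : Partition t₀, ∀ i : Fin Δ.N, (Δ.pts i.succ : ℝ) - Δ.pts i.castSucc < δ := by
  rcases t₀.2.2.eq_or_lt with h | h
  -- For t₀ = T the partition is a single point without steps.
  · refine ⟨⟨0, fun _ => t₀, fun i j hij => by
      have h1 : (i : ℕ) < j := hij
      omega, rfl, Subtype.ext h⟩, fun i => i.elim0⟩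
  · have hpos : 0 < (T : ℝ) - t₀ := sub_pos.2 h
    obtain ⟨n, hn⟩ := exists_nat_gt (((T : ℝ) - t₀) / δ)
    have hn0 : (0 : ℝ) < n := (div_pos hpos hδ).trans hn
    set a : ℝ := ((T : ℝ) - t₀) / n with ha
    have ha0 : 0 < a := div_pos hpos hn0
    have han : n * a = (T : ℝ) - t₀ := by rw [ha]; field_simp
    have hmem : ∀ i : Fin (n + 1), (t₀ : ℝ) + i * a ∈ Set.Icc (0 : ℝ) T := by
      intro i
      have h1 : ((i : ℕ) : ℝ) ≤ n := by exact_mod_cast Nat.lt_succ_iff.1 i.2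
      have h2 : ((i : ℕ) : ℝ) * a ≤ n * a := mul_le_mul_of_nonneg_right h1 ha0.le
      have h3 : 0 ≤ ((i : ℕ) : ℝ) * a := by positivity
      constructor <;> linarith [t₀.2.1]
    refine ⟨⟨n, fun i => ⟨_, hmem i⟩, ?_, ?_, ?_⟩, ?_⟩
    · intro i j hij
      have h1 : ((i : ℕ) : ℝ) < (j : ℕ) := by exact_mod_cast hij
      exact Subtype.mk_lt_mk.2 (by nlinarith)
    · exact Subtype.ext (by simp)
    · refine Subtype.ext ?_
      simp only [Fin.val_last, endTime]
      linarith
    · intro i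
      have h1 : a < δ := by
        rw [ha, div_lt_iff₀ hn0, mul_comm]
        exact (div_lt_iff₀ hδ).1 hn
      simp only [Fin.val_succ, Fin.val_castSucc]
      push_cast
      linarith

/-- The envelope η x exp (C x) is preserved by one step, since 1 + Cδ ≤ exp (Cδ) and the new error
δη is multiplied by an exponential that is at least 1. -/
lemma gronwall_step {C η x δ a : ℝ} (hC : 0 ≤ C) (hη : 0 ≤ η) (hx : 0 ≤ x) (hδ : 0 ≤ δ)
    (ha : a ≤ η * x * Real.exp (C * x)) :
    (1 + C * δ) * a + δ * η ≤ η * (x + δ) * Real.exp (C * (x + δ)) := by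
  have h1 : 1 + C * δ ≤ Real.exp (C * δ) := by linarith [Real.add_one_le_exp (C * δ)]
  have h2 : 1 ≤ Real.exp (C * (x + δ)) := Real.one_le_exp (by positivity)
  have h3 : Real.exp (C * (x + δ)) = Real.exp (C * x) * Real.exp (C * δ) := by
    rw [← Real.exp_add]; ring_nf
  have h4 : (1 + C * δ) * a ≤ (1 + C * δ) * (η * x * Real.exp (C * x)) :=
    mul_le_mul_of_nonneg_left ha (by positivity)
  have h5 : (1 + C * δ) * (η * x * Real.exp (C * x))
      ≤ Real.exp (C * δ) * (η * x * Real.exp (C * x)) :=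
    mul_le_mul_of_nonneg_right h1 (by positivity)
  have h6 : δ * η * 1 ≤ δ * η * Real.exp (C * (x + δ)) :=
    mul_le_mul_of_nonneg_left h2 (by positivity)
  calc (1 + C * δ) * a + δ * η
      ≤ Real.exp (C * δ) * (η * x * Real.exp (C * x)) + δ * η * Real.exp (C * (x + δ)) := by
        linarith
    _ = η * (x + δ) * Real.exp (C * (x + δ)) := by rw [h3]; ring

variable {T : ℝ≥0} {d : ℕ} {U V : Type*}
  [MetricSpace U] [CompactSpace U] [MeasurableSpace U] [BorelSpace U]
  [MetricSpace V] [CompactSpace V] [MeasurableSpace V] [BorelSpace V]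
  {f : Time T → Torus d → P2 (Torus d) → U → V → EuclideanSpace ℝ (Fin d)} {M L : ℝ≥0}

lemma exists_dynamics (hf : Continuous fun p : Time T × Torus d × P2 (Torus d) × U × V =>
      f p.1 p.2.1 p.2.2.1 p.2.2.2.1 p.2.2.2.2)
    (hLip : ∃ L : ℝ, ∀ t x x' m m' u v,
      ‖f t x m u v - f t x' m' u v‖ ≤ L * dist x x' + L * W2 m m') :
    ∃ M L : ℝ≥0, Dynamics f M L := by
  obtain ⟨C, hC⟩ := isCompact_univ.exists_bound_of_continuousOn hf.continuousOn
  obtain ⟨L, hL⟩ := hLip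
  refine ⟨C.toNNReal, L.toNNReal, hf, fun t x m u v => ?_, fun t x x' m m' u v => ?_⟩
  · exact (hC (t, x, m, u, v) (Set.mem_univ _)).trans (Real.le_coe_toNNReal C)
  · exact (hL t x x' m m' u v).trans (add_le_add
      (mul_le_mul_of_nonneg_right (Real.le_coe_toNNReal L) dist_nonneg)
      (mul_le_mul_of_nonneg_right (Real.le_coe_toNNReal L) (W2_nonneg _ _)))

/-- Currying makes t ↦ f(t, ·) a continuous map from a compact interval to a space with the supremum
metric, so no uniform structure on `P2` enters. -/
lemma Dynamics.exists_time_modulus (hf : Dynamics f M L) {ω : ℝ} (hω : 0 < ω) :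
    ∃ δ > 0, ∀ s τ : Time T, dist τ s < δ → ∀ x m u v, ‖f τ x m u v - f s x m u v‖ ≤ ω := by
  let F : C(Time T × (Torus d × P2 (Torus d) × U × V), EuclideanSpace ℝ (Fin d)) := ⟨_, hf.cont⟩
  have hu := CompactSpace.uniformContinuous_of_continuous F.curry.continuous
  obtain ⟨δ, hδ, h⟩ := (Metric.uniformContinuous_iff (f := F.curry)).1 hu ω hω
  refine ⟨δ, hδ, fun s τ hsτ x m u v => ?_⟩
  have h1 := (ContinuousMap.dist_apply_le_dist (f := F.curry τ) (g := F.curry s)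
    (x, m, u, v)).trans (h hsτ).le
  rw [dist_eq_norm] at h1
  exact h1

/-- The first player, aiming at the sublevel sets of a function with the terminal and stability
properties, guarantees its value up to an arbitrary error. -/
lemma Dynamics.exists_strategy [Nonempty U] [Nonempty V] (hf : Dynamics f M L)
    (hI : ∀ t x m (w : EuclideanSpace ℝ (Fin d)),
      (⨅ u, ⨆ v, inner ℝ w (f t x m u v)) = (⨆ v, ⨅ u, inner ℝ w (f t x m u v)))
    {g : P2 (Torus d) → ℝ} (hg : Continuous g) {ψ : Time T → P2 (Torus d) → ℝ}
    (hterm : ∀ m, g m ≤ ψ (endTime T) m)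
    (hstab : ∀ s r : Time T, s < r → ∀ (m : P2 (Torus d)) (β : WM (Torus d) V),
      ∃ κ ∈ D2 (U := U) (constToRelaxed (T := T) β), ∃ μ : C(Time T, P2 (Torus d)),
        IsFlow f s m κ μ ∧ ψ r (μ r) ≤ ψ s m)
    (t₀ : Time T) (m₀ : P2 (Torus d)) {ε : ℝ} (hε : 0 < ε) :
    ∃ (𝔲 : Strategy T d U) (Δ : Partition t₀), ∀ m ∈ X1 f t₀ m₀ 𝔲 Δ,
      g (m (endTime T)) < ψ t₀ m₀ + ε := by
  obtain ⟨ρ, hρ, hgρ⟩ := exists_cost_modulus hg hε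
  set C : ℝ := 4 * L with hC
  have hC0 : 0 ≤ C := by positivity
  obtain ⟨η, hη, hηρ⟩ : ∃ η > 0, η * T * Real.exp (C * T) < ρ := by
    refine ⟨ρ / (2 * ((T + 1) * Real.exp (C * T))), by positivity, ?_⟩
    have h1 : (T : ℝ) / (T + 1) ≤ 1 := div_le_one_of_le₀ (by linarith) (by positivity)
    have h2 : ρ / (2 * ((T + 1) * Real.exp (C * T))) * T * Real.exp (C * T)
        = ρ / 2 * (T / (T + 1)) := by
      field_simp
    rw [h2]
    nlinarith
  -- The budget η is split as η/4 for almost optimality, at most η/4 for the time modulus, and at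
  -- most η/2 for the terms proportional to the mesh, collected in B.
  set ω : ℝ := η / (16 * (√d + 1)) with hωdef
  have hω : 0 < ω := by positivity
  obtain ⟨δ₁, hδ₁, hmod⟩ := hf.exists_time_modulus hω
  set B : ℝ := 8 * L * M * √d + 4 * M ^ 2 with hB
  have hB0 : 0 ≤ B := by positivity
  obtain ⟨Δ, hΔ⟩ := exists_partition_mesh_lt t₀
    (δ := min δ₁ (η / (2 * (B + 1)))) (lt_min hδ₁ (by positivity))
  have herr : ∀ δ : ℝ, 0 ≤ δ → δ ≤ η / (2 * (B + 1)) →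
      4 * (η / 16) + 4 * (ω + 2 * L * M * δ) * √d + 4 * M ^ 2 * δ ≤ η := by
    intro δ h0 h1
    have h2 : 4 * ω * √d ≤ η / 4 := by
      have h3 : √d / (√d + 1) ≤ 1 := div_le_one_of_le₀ (by linarith) (by positivity)
      have h4 : 4 * ω * √d = η / 4 * (√d / (√d + 1)) := by
        rw [hωdef]; field_simp; ring
      rw [h4]
      nlinarith
    have h5 : B * δ ≤ η / 2 := by
      rw [le_div_iff₀ (by positivity)] at h1
      nlinarith
    have h6 : B * δ = 8 * L * M * √d * δ + 4 * M ^ 2 * δ := by rw [hB]; ring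
    linarith
  -- The invariant quantifies over the guide and the plan existentially, so they may be chosen
  -- afresh at each partition point.
  let near : Time T → P2 (Torus d) → Prop := fun t m => ∃ ν : P2 (Torus d),
    ∃ π ∈ plans m.meas ν.meas, ψ t ν ≤ ψ t₀ m₀ ∧
      cost π ≤ η * ((t : ℝ) - t₀) * Real.exp (C * ((t : ℝ) - t₀))
  -- The distribution α is fixed before r, κ and μ are known, as a strategy requires. Where no guide
  -- exists, any α serves.
  have hchoice : ∀ (t : Time T) (m : P2 (Torus d)), ∃ α : WM (Torus d) U, t₀ ≤ t → near t m →
      ∀ r, t < r → (r : ℝ) - t < min δ₁ (η / (2 * (B + 1))) →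
        ∀ κ ∈ D1 (V := V) (constToRelaxed (T := T) α), ∀ μ, IsFlow f t m κ μ → near r (μ r) := by
    intro t m
    by_cases hn : near t m
    swap
    · exact ⟨⟨Kernel.const _ (Measure.dirac (Classical.arbitrary U)), inferInstance⟩,
        fun _ h => absurd h hn⟩
    obtain ⟨ν, π, hπ, hψ, hcost⟩ := hn
    obtain ⟨α, β, h⟩ := hf.exists_extremal_shift t (fun x m w => hI t x m w) hπ
      (ε := η / 16) (by positivity)
    refine ⟨α, fun ht _ r htr hr κ hκ μ hμ => ?_⟩
    obtain ⟨κ', hκ', μ', hμ', hψ'⟩ := hstab t r htr ν β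
    have hr0 : 0 ≤ (r : ℝ) - t := sub_nonneg.2 htr.le
    obtain ⟨π', hπ', hc⟩ := h r htr ω hω.le (fun τ h1 h2 => hmod t τ (by
      have h3 : (t : ℝ) ≤ τ := h1
      have h4 : (τ : ℝ) ≤ r := h2
      rw [Subtype.dist_eq, Real.dist_eq, abs_of_nonneg (by linarith)]
      linarith [min_le_left δ₁ (η / (2 * (B + 1)))])) κ hκ μ hμ κ' hκ' μ' hμ'
    refine ⟨μ' r, π', hπ', hψ'.trans hψ, hc.trans ?_⟩
    have h1 := gronwall_step hC0 hη.le (sub_nonneg.2 (show (t₀ : ℝ) ≤ t from ht)) hr0 hcost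
    have h2 := mul_le_mul_of_nonneg_left (herr _ hr0 (hr.le.trans (min_le_right _ _))) hr0
    have h3 : (t : ℝ) - t₀ + ((r : ℝ) - t) = (r : ℝ) - t₀ := by ring
    rw [h3] at h1
    linarith
  choose 𝔲 h𝔲 using hchoice
  refine ⟨𝔲, Δ, fun m hm => ?_⟩
  have hnear : ∀ i : Fin (Δ.N + 1), near (Δ.pts i) (m (Δ.pts i)) := by
    intro i
    induction i using Fin.induction with
    | zero =>
      rw [Δ.first, hm.1]
      exact ⟨m₀, _, diagonal_mem_plans _, le_rfl, by rw [cost_diagonal]; simp⟩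
    | succ i ih =>
      obtain ⟨κ, hκ, μ, hμ, hmμ⟩ := hm.2 i
      have hlt : Δ.pts i.castSucc < Δ.pts i.succ := Δ.strictMono i.castSucc_lt_succ
      have h0 : t₀ ≤ Δ.pts i.castSucc := by
        exact le_of_eq_of_le Δ.first.symm (Δ.strictMono.monotone (Fin.zero_le _))
      rw [hmμ _ hlt.le le_rfl]
      exact h𝔲 _ _ h0 ih _ hlt (hΔ i) κ hκ.1 μ hμ
  obtain ⟨ν, π, hπ, hψ, hcost⟩ := hnear (Fin.last _)
  rw [Δ.last] at hπ hψ hcost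
  have hT : ((endTime T : Time T) : ℝ) = T := rfl
  rw [hT] at hcost
  have hlt : cost π < ρ := by
    refine lt_of_le_of_lt (hcost.trans ?_) hηρ
    have h1 : (T : ℝ) - t₀ ≤ T := by linarith [t₀.2.1]
    have h2 : 0 ≤ (T : ℝ) - t₀ := sub_nonneg.2 t₀.2.2
    gcongr
  linarith [hgρ _ _ π hπ hlt, hterm ν]

/-- One inclusion suffices: a bound over all flows of the exchanged game is inherited by the infimum
over these flows. -/
lemma X2_subset_X1 (t₀ : Time T) (m₀ : P2 (Torus d)) (𝔳 : Strategy T d V) (Δ : Partition t₀) :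
    X2 f t₀ m₀ 𝔳 Δ ⊆ X1 (fun t x m v u => f t x m u v) t₀ m₀ 𝔳 Δ := by
  rintro m ⟨h0, h⟩
  refine ⟨h0, fun i => ?_⟩
  obtain ⟨κ, ⟨hκ, hu⟩, μ, hμ, hm⟩ := h i
  refine ⟨PairDistr.swap κ, ⟨PairDistr.swap_mem_D1 hκ, fun x => ?_⟩, μ, hμ.swap, hm⟩
  rw [PairDistr.swap_ker_apply]
  exact (MeasurableEquiv.prodComm.measurableEmbedding.ae_map_iff
    (p := fun p : Relaxed T V × Relaxed T U => p.2 ∈ usualControls T U)).2 (hu x)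

/-- Valid without boundedness or nonemptiness, since the real infimum is by convention minus the
supremum of the negated set. -/
lemma iSup_neg_real {A : Type*} (F : A → ℝ) : (⨆ a, -F a) = -⨅ a, F a := by
  have h : Set.range (fun a => -F a) = -Set.range F := by
    ext x
    simp [neg_eq_iff_eq_neg]
  rw [iSup, h, Real.sSup_neg]
  rfl

lemma iInf_neg_real {A : Type*} (F : A → ℝ) : (⨅ a, -F a) = -⨆ a, F a := by
  rw [eq_neg_iff_add_eq_zero, ← neg_eq_iff_add_eq_zero, ← iSup_neg_real]
  simp

/-- Derives the Isaacs condition of the exchanged game from the original one in the direction -w. -/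
lemma iInf_iSup_neg_comm {A B : Type*} {F : A → B → ℝ}
    (h : (⨅ a, ⨆ b, -F a b) = ⨆ b, ⨅ a, -F a b) : (⨅ b, ⨆ a, F a b) = ⨆ a, ⨅ b, F a b := by
  simp only [iSup_neg_real, iInf_neg_real] at h
  exact (neg_injective h).symm

end Values

end

end MeanFieldGame

theorem theorem1 (T : ℝ≥0) (d : ℕ) {U V : Type*}
    [MetricSpace U] [CompactSpace U] [Nonempty U] [MeasurableSpace U] [BorelSpace U]
    [MetricSpace V] [CompactSpace V] [Nonempty V] [MeasurableSpace V] [BorelSpace V]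
    (f : Time T → Torus d → P2 (Torus d) →
      U → V → EuclideanSpace ℝ (Fin d))
    (g : P2 (Torus d) → ℝ)
    (hf : Continuous fun p : Time T × Torus d ×
      P2 (Torus d) × U × V =>
        f p.1 p.2.1 p.2.2.1 p.2.2.2.1 p.2.2.2.2)
    (hg : Continuous g)
    (hLip : ∃ L : ℝ, ∀ t x x' m m' u v,
      ‖f t x m u v - f t x' m' u v‖ ≤ L * dist x x' + L * W2 m m')
    (hIsaacs : ∀ t x m (w : EuclideanSpace ℝ (Fin d)),
      (⨅ u, ⨆ v, inner ℝ w (f t x m u v)) = (⨆ v, ⨅ u, inner ℝ w (f t x m u v))) :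
    (∀ ψ₁ : Time T → P2 (Torus d) → ℝ,
      UStable f g ψ₁ →
        ∀ t₀ m₀, upperValue f g t₀ m₀ ≤ (ψ₁ t₀ m₀ : EReal)) ∧
    (∀ ψ₂ : Time T → P2 (Torus d) → ℝ,
      VStable f g ψ₂ →
        ∀ t₀ m₀, (ψ₂ t₀ m₀ : EReal) ≤ lowerValue f g t₀ m₀) := by
  obtain ⟨M, L, hdyn⟩ := exists_dynamics hf hLip
  refine ⟨fun ψ hψ t₀ m₀ => ?_, fun ψ hψ t₀ m₀ => ?_⟩
  -- It suffices to guarantee every real z above the value of ψ; the difference is the admissible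
  -- error.
  · refine EReal.le_of_forall_lt_iff_le.1 fun z hz => ?_
    have hz' : ψ t₀ m₀ < z := EReal.coe_lt_coe_iff.1 hz
    obtain ⟨𝔲, Δ, h⟩ := hdyn.exists_strategy hIsaacs hg hψ.terminal hψ.stable t₀ m₀
      (sub_pos.2 hz')
    refine iInf₂_le_of_le 𝔲 Δ (iSup₂_le fun m hm => EReal.coe_le_coe_iff.2 ?_)
    linarith [h m hm]
  · refine EReal.ge_of_forall_gt_iff_ge.1 fun z hz => ?_
    have hz' : z < ψ t₀ m₀ := EReal.coe_lt_coe_iff.1 hz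
    -- In the exchanged game the second player minimizes -g, and v-stability of ψ becomes the
    -- stability required of -ψ, with consistency with α passing from `D1` to `D2`.
    obtain ⟨𝔳, Δ, h⟩ := hdyn.swap.exists_strategy (g := fun m => -g m) (ψ := fun t m => -ψ t m)
      (fun t x m w => iInf_iSup_neg_comm (F := fun u v => inner ℝ w (f t x m u v)) (by
        simpa only [inner_neg_left] using hIsaacs t x m (-w)))
      hg.neg (fun m => neg_le_neg (hψ.terminal m)) (fun s r hsr m α => by
        obtain ⟨κ, hκ, μ, hμ, h⟩ := hψ.stable s r hsr m α
        exact ⟨PairDistr.swap κ, PairDistr.swap_mem_D2 hκ, μ, hμ.swap, neg_le_neg h⟩)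
      t₀ m₀ (sub_pos.2 hz')
    refine le_iSup₂_of_le 𝔳 Δ (le_iInf₂ fun m hm => EReal.coe_le_coe_iff.2 ?_)
    linarith [h m (X2_subset_X1 t₀ m₀ 𝔳 Δ hm)]
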